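/- Let $n\ge 1$. For $\alpha_0,\dots,\alpha_{n-2}\in\mathbb D$ and $\alpha_{n-1}\in S^1$ put $\rho_k=\sqrt{1-|\alpha_k|^2}$ and $\Xi_k=\begin{bmatrix}\bar\alpha_k&\rho_k\\ \rho_k&-\alpha_k\end{bmatrix}$ for $0\le k\le n-2$, $\Xi_{-1}=[1]$, $\Xi_{n-1}=[\bar\alpha_{n-1}]$. The associated $n\times n$ CMV matrix is the unitary matrix $\mathcal C=\mathcal L\mathcal M$ with $\mathcal L=\mathrm{diag}(\Xi_0,\Xi_2,\dots)$ and $\mathcal M=\mathrm{diag}(\Xi_{-1},\Xi_1,\Xi_3,\dots)$. Its eigenvalues $e^{i\theta_1},\dots,e^{i\theta_n}$ are distinct; let $\mu_j=|\langle e_1,\psi_j\rangle|^2$, with $\psi_j$ a unit eigenvector for $e^{i\theta_j}$, be the mass that the spectral measure of $\mathcal C$ and $e_1=[1,0,\dots,0]^T$ gives to $e^{i\theta_j}$. Write $\alpha_k=u_k+iv_k$ for $0\le k\le n-2$ and $\alpha_{n-1}=e^{i\phi}$. Let $\Omega\subset\mathbb R^{2n-1}$ be the open set of all $(\theta_1,\mu_1,\dots,\theta_{n-1},\mu_{n-1},\theta_n)$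 such that $e^{i\theta_1},\dots,e^{i\theta_n}$ are distinct and $\mu_1,\dots,\mu_n>0$, where $\mu_n=1-\mu_1-\dots-\mu_{n-1}$. Then there is a continuous map $$(\theta_1,\mu_1,\dots,\theta_{n-1},\mu_{n-1},\theta_n)\mapsto(u_0,v_0,\dots,u_{n-2},v_{n-2},\phi)$$ on $\Omega$ that sends each point to Verblunsky coordinates of a CMV matrix with these eigenvalues $e^{i\theta_j}$ and masses $\mu_j$. Every such continuous map on an open subset of $\Omega$ (that is, with any continuous choice of the angle $\phi$) is differentiable, and its Jacobian is $$\det\left[\frac{\partial(u_0,v_0,\dots,u_{n-2},v_{n-2},\phi)}{\partial(\theta_1,\mu_1,\dots,\theta_{n-1},\mu_{n-1},\theta_n)}\right]=-2^{1-n}\,\frac{\rho_0^2\cdots\rho_{n-2}^2}{\mu_1\cdots\mu_n}.$$ -/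

import Mathlib

noncomputable section

namespace CMV

/-- `ρ = √(1 - |α|²)`. -/
def rho (a : ℂ) : ℝ := Real.sqrt (1 - ‖a‖ ^ 2)

/-- The block-diagonal matrix `L = diag(Ξ₀, Ξ₂, Ξ₄, …)` of size `n`, where
`Ξ_k = [conj α_k, ρ_k; ρ_k, -α_k]` occupies rows and columns `k, k+1` (counted from `0`), and
`Ξ_{n-1} = [conj α_{n-1}]` is `1 × 1`. -/
def L {n : ℕ} (α : Fin n → ℂ) : Matrix (Fin n) (Fin n) ℂ :=
  Matrix.of fun i j =>
    if i = j then
      if Even i.val then star (α i)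
      else -α ⟨i.val - 1, (Nat.sub_le _ _).trans_lt i.isLt⟩
    else if j.val = i.val + 1 ∧ Even i.val then (rho (α i) : ℂ)
    else if i.val = j.val + 1 ∧ Even j.val then (rho (α j) : ℂ)
    else 0

/-- The block-diagonal matrix `M = diag(Ξ₋₁, Ξ₁, Ξ₃, …)` of size `n`, with `Ξ₋₁ = [1]`. -/
def M {n : ℕ} (α : Fin n → ℂ) : Matrix (Fin n) (Fin n) ℂ :=
  Matrix.of fun i j =>
    if i = j then
      if i.val = 0 then 1
      else if Odd i.val then star (α i)
      else -α ⟨i.val - 1, (Nat.sub_le _ _).trans_lt i.isLt⟩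
    else if j.val = i.val + 1 ∧ Odd i.val then (rho (α i) : ℂ)
    else if i.val = j.val + 1 ∧ Odd j.val then (rho (α j) : ℂ)
    else 0

/-- The CMV matrix `C = L M` with Verblunsky coefficients `α₀, …, α_{n-1}`. -/
def cmv {n : ℕ} (α : Fin n → ℂ) : Matrix (Fin n) (Fin n) ℂ := L α * M α

/-- `C` has eigenvalues `e^{iθ_j}`, and the spectral measure of `C` and the first basis vector
gives them the masses `μ_j`: the columns of a unitary matrix `V` are orthonormal eigenvectors `ψ_j`
with eigenvalues `e^{iθ_j}`, and `μ_j = |⟨e₁, ψ_j⟩|²`. -/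
def HasSpectralData {n : ℕ} [NeZero n] (C : Matrix (Fin n) (Fin n) ℂ) (θ μ : Fin n → ℝ) : Prop :=
  ∃ V ∈ Matrix.unitaryGroup (Fin n) ℂ,
    C * V = V * Matrix.diagonal (fun j => Complex.exp (θ j * Complex.I)) ∧
    ∀ j, μ j = ‖V 0 j‖ ^ 2

/-- The space `ℝ^{2n-1}` with `n = m + 1`. A point is read either as
`(θ₁, μ₁, …, θ_{n-1}, μ_{n-1}, θ_n)` or as `(u₀, v₀, …, u_{n-2}, v_{n-2}, φ)`:
the pairs are the values of the first component, in the same order. -/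
abbrev Coord (m : ℕ) : Type := (Fin m → ℝ × ℝ) × ℝ

/-- The angles `θ₁, …, θ_n`. -/
def theta {m : ℕ} (x : Coord m) : Fin (m + 1) → ℝ :=
  Fin.snoc (fun k => (x.1 k).1) x.2

/-- The masses `μ₁, …, μ_n`, where `μ_n = 1 - μ₁ - ⋯ - μ_{n-1}`. -/
def mass {m : ℕ} (x : Coord m) : Fin (m + 1) → ℝ :=
  Fin.snoc (fun k => (x.1 k).2) (1 - ∑ k, (x.1 k).2)

/-- The parameters of probability measures on the circle supported at exactly `n = m + 1` points. -/
def specDomain (m : ℕ) : Set (Coord m) :=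
  {x | (Function.Injective fun j => Complex.exp (theta x j * Complex.I)) ∧ ∀ j, 0 < mass x j}

/-- The Verblunsky coefficients `α_k = u_k + i v_k` for `k ≤ n - 2`, and `α_{n-1} = e^{iφ}`. -/
def verblunsky {m : ℕ} (y : Coord m) : Fin (m + 1) → ℂ :=
  Fin.snoc (fun k => (⟨(y.1 k).1, (y.1 k).2⟩ : ℂ)) (Complex.exp (y.2 * Complex.I))

/-- `y = (u₀, v₀, …, φ)` are Verblunsky coordinates of a CMV matrix whose eigenvalue angles and
masses are given by `x = (θ₁, μ₁, …, θ_n)`. -/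
def Corresponds {m : ℕ} (x y : Coord m) : Prop :=
  (∀ k : Fin m, ‖verblunsky y k.castSucc‖ < 1) ∧
    HasSpectralData (cmv (verblunsky y)) (theta x) (mass x)

/-- `F` is the change of variables `(θ, μ) ↦ (u, v, φ)` on `U`. As `φ` is an angle, `F` is
determined up to the choice of a continuous branch of `φ`. -/
def IsChangeOfVariables {m : ℕ} (U : Set (Coord m)) (F : Coord m → Coord m) : Prop :=
  ContinuousOn F U ∧ ∀ x ∈ U, Corresponds x (F x)

end CMV

end

/-!
The moments `c_r = ⟨e₀, C^r e₀⟩ = ∑ μ_j e^{irθ_j}`, for `r = 1, …, n` together with the conjugates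
of those for `r < n`, are `2n - 1` functions that can be differentiated in either set of
coordinates. Since `c_{r+1} = conj α_r (ρ₀ ⋯ ρ_{r-1})² + (a function of α₀, …, α_{r-1})`, the
Verblunsky coefficients are recovered successively from the moments, and the Jacobian of the moments
with respect to `(u, v, φ)` is triangular. With respect to `(θ, μ)` it is a confluent Vandermonde
determinant. The quotient of the two is evaluated by means of
`∏_k (ρ₀ ⋯ ρ_{k-1})² = ∏ μ_j · |Vandermonde|²` and `∏ e^{iθ_j} = det C = (-1)^{n-1} conj α_{n-1}`.

A CMV matrix with given eigenvalues and masses is the matrix of multiplication by `z` in the basis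
that the Szegő recursion produces by orthonormalising `1, z, z⁻¹, z², …`; the continuous choice of
`φ` comes from `det C`.
-/

noncomputable section

namespace CMV

open Matrix

section Rho

theorem rho_pos {a : ℂ} (h : ‖a‖ < 1) : 0 < rho a :=
  Real.sqrt_pos.2 (by nlinarith [norm_nonneg a])

theorem rho_sq {a : ℂ} (h : ‖a‖ ≤ 1) : rho a ^ 2 = 1 - ‖a‖ ^ 2 :=
  Real.sq_sqrt (by nlinarith [norm_nonneg a])

theorem rho_ne_zero {a : ℂ} (h : ‖a‖ < 1) : (rho a : ℂ) ≠ 0 :=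
  Complex.ofReal_ne_zero.2 (rho_pos h).ne'

theorem rho_star (a : ℂ) : rho (star a) = rho a := by rw [rho, rho, norm_star]

theorem star_rho (a : ℂ) : star (rho a : ℂ) = rho a := Complex.conj_ofReal _

theorem ofReal_rho_sq {a : ℂ} (h : ‖a‖ ≤ 1) : (rho a : ℂ) ^ 2 = 1 - star a * a := by
  rw [Complex.star_def, Complex.conj_mul']
  exact_mod_cast rho_sq h

/-- The product `ρ₀ ⋯ ρ_{i-1}`: the norm of the `i`-th monic orthogonal polynomial. -/
def rhoProd {n : ℕ} (α : Fin n → ℂ) (i : Fin n) : ℝ := ∏ l ∈ Finset.Iio i, rho (α l)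

theorem rhoProd_pos {n : ℕ} {α : Fin n → ℂ} {i : Fin n} (h : ∀ l < i, ‖α l‖ < 1) :
    0 < rhoProd α i :=
  Finset.prod_pos fun l hl => rho_pos (h l (Finset.mem_Iio.1 hl))

theorem rhoProd_congr {n : ℕ} {α β : Fin n → ℂ} {i : Fin n} (h : ∀ l < i, α l = β l) :
    rhoProd α i = rhoProd β i :=
  Finset.prod_congr rfl fun l hl => by rw [h l (Finset.mem_Iio.1 hl)]

end Rho

section Factor

variable {n : ℕ} (α β : Fin n → ℂ) (r : ℕ) (v : Fin n → ℂ)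

/-- The one of the factors `L`, `M` that contains the block `Ξ_r`. -/
def factor : Matrix (Fin n) (Fin n) ℂ :=
  if Even r then L α else M α

theorem factor_even (t : ℕ) : factor α (2 * t) = L α := by simp [factor]

theorem factor_odd (t : ℕ) : factor α (2 * t + 1) = M α := by simp [factor]

theorem factor_apply (i j : Fin n) :
    factor α r i j =
      if i = j then
        if Even (i.val + r) then star (α i)
        else if i.val = 0 then 1
        else -α ⟨i.val - 1, (Nat.sub_le _ _).trans_lt i.isLt⟩
      else if j.val = i.val + 1 ∧ Even (i.val + r) then (rho (α i) : ℂ)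
      else if i.val = j.val + 1 ∧ Even (j.val + r) then (rho (α j) : ℂ)
      else 0 := by
  by_cases hr : Even r
  · simp only [factor, hr, if_true, L, Matrix.of_apply, Nat.even_add]
    grind
  · simp only [factor, hr, if_false, M, Matrix.of_apply, Nat.even_add]
    grind

theorem transpose_factor : (factor α r)ᵀ = factor α r := by
  ext i j
  rw [transpose_apply, factor_apply, factor_apply]
  grind

variable {α r} in
theorem factor_mulVec_top {i j : Fin n} (hij : j.val = i.val + 1) (h : Even (i.val + r)) :
    (factor α r *ᵥ v) i = star (α i) * v i + rho (α i) * v j := by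
  rw [mulVec, dotProduct, Fintype.sum_eq_add i j (by grind) fun k hk => ?_]
  all_goals simp only [factor_apply]; grind

variable {α r} in
theorem factor_mulVec_last {i : Fin n} (hi : i.val + 1 = n) (h : Even (i.val + r)) :
    (factor α r *ᵥ v) i = star (α i) * v i := by
  rw [mulVec, dotProduct, Fintype.sum_eq_single i fun k hk => ?_]
  all_goals simp only [factor_apply]; grind

variable {α r} in
theorem factor_mulVec_bot {i j : Fin n} (hij : j.val = i.val + 1) (h : Even (i.val + r)) :
    (factor α r *ᵥ v) j = rho (α i) * v i - α i * v j := by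
  rw [mulVec, dotProduct, Fintype.sum_eq_add i j (by grind) fun k hk => ?_]
  all_goals simp only [factor_apply]; grind

variable {α r} in
theorem factor_mulVec_zero {i : Fin n} (hi : i.val = 0) (h : ¬ Even r) :
    (factor α r *ᵥ v) i = v i := by
  rw [mulVec, dotProduct, Fintype.sum_eq_single i fun k hk => ?_]
  all_goals simp only [factor_apply]; grind

theorem factor_row_cases (i : Fin n) :
    (Even (i.val + r) ∧ ∃ j : Fin n, j.val = i.val + 1) ∨ (Even (i.val + r) ∧ i.val + 1 = n) ∨
      (∃ j : Fin n, i.val = j.val + 1 ∧ Even (j.val + r)) ∨ (i.val = 0 ∧ ¬ Even r) := by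
  by_cases h : Even (i.val + r)
  · by_cases hn : i.val + 1 = n
    · exact .inr (.inl ⟨h, hn⟩)
    · exact .inl ⟨h, ⟨i.val + 1, by omega⟩, rfl⟩
  · by_cases hi : i.val = 0
    · exact .inr (.inr (.inr ⟨hi, by simpa [hi] using h⟩))
    · exact .inr (.inr (.inl ⟨⟨i.val - 1, by omega⟩, by grind, by grind⟩))

variable {α β} in
theorem factor_mulVec_apply_congr {i : Fin n} (h : ∀ l ≤ i, α l = β l) :
    (factor α r *ᵥ v) i = (factor β r *ᵥ v) i := by
  rcases factor_row_cases r i with ⟨he, j, hj⟩ | ⟨he, hn⟩ | ⟨j, hj, he⟩ | ⟨h0, hr⟩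
  · rw [factor_mulVec_top v hj he, factor_mulVec_top v hj he, h i le_rfl]
  · rw [factor_mulVec_last v hn he, factor_mulVec_last v hn he, h i le_rfl]
  · rw [factor_mulVec_bot v hj he, factor_mulVec_bot v hj he, h j (Fin.le_def.2 (by omega))]
  · rw [factor_mulVec_zero v h0 hr, factor_mulVec_zero v h0 hr]

end Factor

section Moments

variable {n : ℕ} [NeZero n] {α β : Fin n → ℂ}

/-- The vectors `e₀, L e₀, M L e₀, L M L e₀, …`. -/
def krylov (α : Fin n → ℂ) : ℕ → Fin n → ℂ
  | 0 => Pi.single 0 1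
  | r + 1 => factor α r *ᵥ krylov α r

theorem krylov_eq_zero {r : ℕ} {i : Fin n} (h : r < i.val) : krylov α r i = 0 := by
  induction r generalizing i with
  | zero => exact Pi.single_eq_of_ne (by rintro rfl; simp at h) 1
  | succ r ih =>
    rw [krylov]
    rcases factor_row_cases r i with ⟨he, j, hj⟩ | ⟨he, hn⟩ | ⟨j, hj, he⟩ | ⟨h0, -⟩
    · rw [factor_mulVec_top _ hj he, ih (by omega), ih (by omega), mul_zero, mul_zero, add_zero]
    · rw [factor_mulVec_last _ hn he, ih (by omega), mul_zero]
    · rw [factor_mulVec_bot _ hj he, ih (by omega), ih (by omega), mul_zero, mul_zero, sub_zero]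
    · omega

theorem krylov_succ_self (α : Fin n → ℂ) {i j : Fin n} (h : j.val = i.val + 1) :
    krylov α j j = rho (α i) * krylov α i i := by
  have hj : krylov α j j = (factor α i *ᵥ krylov α i) j := by rw [h, krylov]
  rw [hj, factor_mulVec_bot _ h ⟨i, rfl⟩, krylov_eq_zero (i := j) (by omega),
    mul_zero, sub_zero]

theorem krylov_self (α : Fin n → ℂ) (i : Fin n) : krylov α i i = rhoProd α i := by
  obtain ⟨k, hk⟩ := i
  induction k with
  | zero =>
    have hIio : Finset.Iio (⟨0, hk⟩ : Fin n) = ∅ := by ext; simp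
    rw [rhoProd, hIio, Finset.prod_empty, Complex.ofReal_one]
    exact Pi.single_eq_same _ _
  | succ k ih =>
    have hIio : Finset.Iio (⟨k + 1, hk⟩ : Fin n) =
        insert ⟨k, by omega⟩ (Finset.Iio ⟨k, by omega⟩) := by
      ext l
      simp only [Finset.mem_Iio, Finset.mem_insert, Fin.lt_def, Fin.ext_iff]
      omega
    rw [krylov_succ_self α (i := ⟨k, by omega⟩) rfl, ih, rhoProd, rhoProd, hIio,
      Finset.prod_insert (by simp), Complex.ofReal_mul]

theorem krylov_congr {r : ℕ} (h : ∀ l : Fin n, l.val < r → α l = β l) :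
    krylov α r = krylov β r := by
  induction r with
  | zero => rfl
  | succ r ih =>
    ext i
    rcases lt_trichotomy i.val (r + 1) with hi | hi | hi
    · rw [krylov, krylov, ← ih fun l hl => h l (by omega)]
      exact factor_mulVec_apply_congr r _ fun l hl => h l ((Fin.le_def.1 hl).trans_lt hi)
    · rw [← hi, krylov_self, krylov_self, rhoProd_congr fun l hl => h l (hi ▸ hl)]
    · rw [krylov_eq_zero hi, krylov_eq_zero hi]

/-- The moment `⟨e₀, C^r e₀⟩` of the spectral measure of the CMV matrix `C`. -/
def moment (α : Fin n → ℂ) (r : ℕ) : ℂ := (cmv α ^ r) 0 0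

theorem M_mulVec_single_zero (α : Fin n → ℂ) : M α *ᵥ Pi.single 0 1 = Pi.single 0 1 := by
  ext i
  simp only [mulVec_single, MulOpposite.op_one, one_smul, col_apply, M, Matrix.of_apply,
    Pi.single_apply]
  grind [Fin.val_zero]

theorem krylov_even (α : Fin n → ℂ) (t : ℕ) :
    krylov α (2 * t) = (cmv α)ᵀ ^ t *ᵥ Pi.single 0 1 := by
  have hL : (L α)ᵀ = L α := factor_even α 0 ▸ transpose_factor α _
  have hM : (M α)ᵀ = M α := factor_odd α 0 ▸ transpose_factor α _
  induction t with
  | zero => rw [mul_zero, krylov, pow_zero, one_mulVec]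
  | succ t ih =>
    rw [mul_add_one, krylov, krylov, ih, factor_even, factor_odd, pow_succ', cmv, transpose_mul,
      hL, hM, mulVec_mulVec, mulVec_mulVec, Matrix.mul_assoc]

theorem krylov_odd (α : Fin n → ℂ) (t : ℕ) :
    krylov α (2 * t + 1) = cmv α ^ (t + 1) *ᵥ Pi.single 0 1 := by
  have hL : (L α)ᵀ = L α := factor_even α 0 ▸ transpose_factor α _
  have hM : (M α)ᵀ = M α := factor_odd α 0 ▸ transpose_factor α _
  have h_pow : (M α * L α) ^ t * M α = M α * cmv α ^ t :=
    ((SemiconjBy.pow_right (show SemiconjBy (M α) (cmv α) (M α * L α) by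
      rw [SemiconjBy, cmv, Matrix.mul_assoc]) t).eq).symm
  rw [krylov, krylov_even, factor_even, cmv, transpose_mul, hL, hM, ← cmv,
    ← M_mulVec_single_zero α, mulVec_mulVec, mulVec_mulVec, Matrix.mul_assoc, h_pow,
    ← Matrix.mul_assoc, ← cmv, ← pow_succ', M_mulVec_single_zero]

theorem moment_succ (α : Fin n → ℂ) (r : ℕ) :
    moment α (r + 1) = krylov α r ⬝ᵥ krylov α (r + 1) := by
  have h_dot (s t : ℕ) :
      ((cmv α)ᵀ ^ s *ᵥ Pi.single 0 1) ⬝ᵥ (cmv α ^ t *ᵥ Pi.single 0 1) = moment α (s + t) := by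
    rw [← transpose_pow, mulVec_transpose, ← dotProduct_mulVec, mulVec_mulVec, ← pow_add, moment]
    simp
  obtain ⟨t, rfl | rfl⟩ := Nat.even_or_odd' r
  · rw [krylov_odd, krylov_even, h_dot]
    congr 1
    ring
  · rw [krylov_odd, show 2 * t + 1 + 1 = 2 * (t + 1) by ring, krylov_even, dotProduct_comm, h_dot]
    congr 1
    ring

theorem factor_mulVec_krylov_self (α : Fin n → ℂ) (r : Fin n) :
    (factor α r *ᵥ krylov α r) r = star (α r) * rhoProd α r := by
  rcases factor_row_cases r r with ⟨he, j, hj⟩ | ⟨he, hn⟩ | ⟨j, hj, he⟩ | ⟨h0, hr⟩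
  · rw [factor_mulVec_top _ hj he, krylov_eq_zero (i := j) (by omega), krylov_self, mul_zero,
      add_zero]
  · rw [factor_mulVec_last _ hn he, krylov_self]
  · grind
  · grind

theorem moment_succ_sub (r : Fin n) (h : ∀ l < r, α l = β l) :
    moment α (r + 1) - moment β (r + 1) = star (α r - β r) * rhoProd α r ^ 2 := by
  have h_krylov : krylov β r = krylov α r := krylov_congr fun l hl => (h l hl).symm
  rw [moment_succ, moment_succ, h_krylov, ← dotProduct_sub, dotProduct, Fintype.sum_eq_single r]
  · rw [Pi.sub_apply, krylov, krylov, factor_mulVec_krylov_self, factor_mulVec_krylov_self,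
      krylov_self, rhoProd_congr h, star_sub]
    ring
  · intro i hi
    rcases hi.lt_or_gt with hi | hi
    · rw [Pi.sub_apply, krylov, krylov, h_krylov,
        factor_mulVec_apply_congr r _ fun l hl => h l (hl.trans_lt hi), sub_self, mul_zero]
    · rw [krylov_eq_zero hi, zero_mul]

/-- The coefficients below `r`, continued by `0`. -/
def truncate (α : Fin n → ℂ) (r : Fin n) : Fin n → ℂ := fun l => if l < r then α l else 0

theorem moment_succ_eq_truncate (α : Fin n → ℂ) (r : Fin n) :
    moment α (r + 1) = star (α r) * rhoProd α r ^ 2 + moment (truncate α r) (r + 1) := by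
  rw [← sub_eq_iff_eq_add, moment_succ_sub r fun l hl => by rw [truncate, if_pos hl], truncate,
    if_neg (lt_irrefl r), sub_zero]

end Moments

section Differentiability

variable {E : Type*} [NormedAddCommGroup E] [NormedSpace ℝ E] {x : E}

theorem differentiableAt_rho {f : E → ℂ} (hf : DifferentiableAt ℝ f x) (h : ‖f x‖ < 1) :
    DifferentiableAt ℝ (fun y => rho (f y)) x :=
  ((hf.norm_sq ℝ).const_sub 1).sqrt (by nlinarith [norm_nonneg (f x)])

theorem differentiableAt_ofReal_comp {f : E → ℝ} (hf : DifferentiableAt ℝ f x) :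
    DifferentiableAt ℝ (fun y => (f y : ℂ)) x :=
  Complex.ofRealCLM.differentiableAt.comp x hf

variable {n : ℕ} {γ : E → Fin n → ℂ}

theorem differentiableAt_rhoProd {r : Fin n} (hd : ∀ l < r, DifferentiableAt ℝ (γ · l) x)
    (hn : ∀ l < r, ‖γ x l‖ < 1) : DifferentiableAt ℝ (fun y => rhoProd (γ y) r) x :=
  (HasFDerivAt.finsetProd fun l hl =>
    have hl := Finset.mem_Iio.1 hl
    (differentiableAt_rho (hd l hl) (hn l hl)).hasFDerivAt).differentiableAt

theorem differentiableAt_factor_apply (hd : ∀ l, DifferentiableAt ℝ (γ · l) x)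
    (hn : ∀ l, ‖γ x l‖ < 1) (r : ℕ) (i j : Fin n) :
    DifferentiableAt ℝ (fun y => factor (γ y) r i j) x := by
  have h_rho (l : Fin n) : DifferentiableAt ℝ (fun y => (rho (γ y l) : ℂ)) x :=
    differentiableAt_ofReal_comp (differentiableAt_rho (hd l) (hn l))
  simp only [factor_apply]
  split_ifs <;> fun_prop (disch := assumption)

variable [NeZero n]

theorem differentiableAt_krylov (hd : ∀ l, DifferentiableAt ℝ (γ · l) x)
    (hn : ∀ l, ‖γ x l‖ < 1) (r : ℕ) (i : Fin n) :
    DifferentiableAt ℝ (fun y => krylov (γ y) r i) x := by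
  induction r generalizing i with
  | zero => exact differentiableAt_const _
  | succ r ih =>
    simp only [krylov, mulVec, dotProduct]
    exact DifferentiableAt.fun_sum fun j _ => (differentiableAt_factor_apply hd hn r i j).mul (ih j)

theorem differentiableAt_moment_truncate {r : Fin n}
    (hd : ∀ l < r, DifferentiableAt ℝ (γ · l) x) (hn : ∀ l < r, ‖γ x l‖ < 1) :
    DifferentiableAt ℝ (fun y => moment (truncate (γ y) r) (r + 1)) x := by
  have hd' (l : Fin n) : DifferentiableAt ℝ (fun y => truncate (γ y) r l) x := by
    by_cases h : l < r <;> simp [truncate, h, hd]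
  have hn' (l : Fin n) : ‖truncate (γ x) r l‖ < 1 := by
    by_cases h : l < r <;> simp [truncate, h, hn]
  simp only [moment_succ]
  exact DifferentiableAt.fun_sum fun i _ =>
    (differentiableAt_krylov hd' hn' r i).mul (differentiableAt_krylov hd' hn' (r + 1) i)

theorem differentiableAt_moment {r : Fin n} (hd : ∀ l ≤ r, DifferentiableAt ℝ (γ · l) x)
    (hn : ∀ l < r, ‖γ x l‖ < 1) : DifferentiableAt ℝ (fun y => moment (γ y) (r + 1)) x := by
  have hd_lt (l : Fin n) (hl : l < r) := hd l hl.le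
  have h_rho := differentiableAt_ofReal_comp (differentiableAt_rhoProd hd_lt hn)
  rw [funext fun y => moment_succ_eq_truncate (γ y) r]
  exact ((hd r le_rfl).star.mul (h_rho.pow 2)).add (differentiableAt_moment_truncate hd_lt hn)

theorem hasDerivAt_moment {γ : ℝ → Fin n → ℂ} {t : ℝ} {r : Fin n} {d : ℂ}
    (hc : ∀ s, ∀ l < r, γ s l = γ t l) (hd : HasDerivAt (γ · r) d t) :
    HasDerivAt (fun s => moment (γ s) (r + 1)) (star d * rhoProd (γ t) r ^ 2) t := by
  have h_affine (s : ℝ) : moment (γ s) (r + 1) =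
      star (γ s r - γ t r) * rhoProd (γ t) r ^ 2 + moment (γ t) (r + 1) := by
    rw [← sub_eq_iff_eq_add, moment_succ_sub r (hc s), rhoProd_congr (hc s)]
  rw [funext h_affine]
  exact (((hd.sub_const _).star).mul_const _).add_const _

theorem differentiableAt_of_differentiableAt_moment
    (hc : ∀ k : Fin n, DifferentiableAt ℝ (fun y => moment (γ y) (k + 1)) x)
    (hn : ∀ᶠ y in nhds x, ∀ k : Fin n, k.val + 1 < n → ‖γ y k‖ < 1) (k : Fin n) :
    DifferentiableAt ℝ (γ · k) x := by
  induction k using WellFoundedLT.induction with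
  | ind k ih =>
    have hn_lt {y : E} (hy : ∀ k : Fin n, k.val + 1 < n → ‖γ y k‖ < 1) (l : Fin n) (hl : l < k) :
        ‖γ y l‖ < 1 := hy l (by rw [Fin.lt_def] at hl; omega)
    have h_ne {y : E} (hy : ∀ k : Fin n, k.val + 1 < n → ‖γ y k‖ < 1) :
        (rhoProd (γ y) k : ℂ) ^ 2 ≠ 0 :=
      pow_ne_zero 2 (Complex.ofReal_ne_zero.2 (rhoProd_pos (hn_lt hy)).ne')
    have hnx := hn.self_of_nhds
    have h_rho := differentiableAt_ofReal_comp (differentiableAt_rhoProd ih (hn_lt hnx))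
    have h_quot := ((hc k).sub (differentiableAt_moment_truncate ih (hn_lt hnx))).mul
      ((h_rho.pow 2).inv (h_ne hnx))
    refine h_quot.star.congr_of_eventuallyEq (hn.mono fun y hy => ?_)
    simp only [Pi.mul_apply, Pi.sub_apply, Pi.inv_apply, Pi.pow_apply,
      moment_succ_eq_truncate (γ y) k, add_sub_cancel_right, mul_inv_cancel_right₀ (h_ne hy),
      star_star]

end Differentiability

section Determinant

theorem L_submatrix {n : ℕ} (α : Fin (n + 2) → ℂ) :
    (L α).submatrix (finSumFinEquiv.trans (finCongr (add_comm 2 n)))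
        (finSumFinEquiv.trans (finCongr (add_comm 2 n))) =
      fromBlocks !![star (α 0), (rho (α 0) : ℂ); (rho (α 0) : ℂ), -α 0] 0 0
        (L fun i => α i.succ.succ) := by
  have h_inr (i : Fin n) :
      finSumFinEquiv.trans (finCongr (add_comm 2 n)) (.inr i) = i.succ.succ :=
    Fin.ext (add_comm 2 i.val)
  ext (i | i) (j | j) <;> rw [submatrix_apply]
  · fin_cases i <;> fin_cases j <;> simp [L] <;> rfl
  · rw [h_inr, fromBlocks_apply₁₂, L, Matrix.of_apply]
    fin_cases i <;> simp [Fin.ext_iff]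
  · rw [h_inr, fromBlocks_apply₂₁, L, Matrix.of_apply]
    fin_cases j <;> simp [Fin.ext_iff]
  · simp only [h_inr, fromBlocks_apply₂₂, L, Matrix.of_apply, Fin.succ_inj, Fin.val_succ,
      Nat.even_add_one, not_not]
    grind

theorem det_L_add_two {n : ℕ} {α : Fin (n + 2) → ℂ} (h : ‖α 0‖ ≤ 1) :
    (L α).det = -(L fun i => α i.succ.succ).det := by
  have h_block : (!![star (α 0), (rho (α 0) : ℂ); (rho (α 0) : ℂ), -α 0]).det = -1 := by
    rw [det_fin_two_of]
    linear_combination -ofReal_rho_sq h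
  rw [← det_submatrix_equiv_self (finSumFinEquiv.trans (finCongr (add_comm 2 n))), L_submatrix,
    det_fromBlocks_zero₂₁, h_block, neg_one_mul]

theorem det_M {n : ℕ} (α : Fin (n + 1) → ℂ) : (M α).det = (L fun i => α i.succ).det := by
  have h_sub : (M α).submatrix Fin.succ Fin.succ = L fun i => α i.succ := by
    ext i j
    simp [M, L]
    grind
  have h_zero (i : Fin n) : M α 0 i.succ = 0 := by simp [M, (Fin.succ_ne_zero i).symm]
  have h_one : M α 0 0 = 1 := by simp [M]
  rw [det_succ_row_zero, Fin.sum_univ_succ, Fin.succAbove_zero, h_sub, h_one]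
  simp [h_zero]

theorem det_cmv {m : ℕ} {α : Fin (m + 1) → ℂ} (h : ∀ k : Fin m, ‖α k.castSucc‖ ≤ 1) :
    (cmv α).det = (-1) ^ m * star (α (Fin.last m)) := by
  induction m with
  | zero => simp [cmv, L, M, mul_apply]
  | succ m ih =>
    have h_tail : (cmv fun i => α i.succ).det = (-1) ^ m * star (α (Fin.last (m + 1))) :=
      ih fun k => h k.succ
    rw [cmv, det_mul, det_M] at h_tail ⊢
    rw [det_L_add_two (h 0), pow_succ]
    linear_combination -h_tail

end Determinant

section SpectralData

variable {n : ℕ}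

theorem pow_apply_of_diagonalization {C V : Matrix (Fin n) (Fin n) ℂ} {z : Fin n → ℂ}
    (hV : V ∈ unitaryGroup (Fin n) ℂ) (hC : C * V = V * diagonal z) (r : ℕ) (i k : Fin n) :
    (C ^ r) i k = ∑ j, V i j * z j ^ r * star (V k j) := by
  have h_pow : C ^ r * V = V * diagonal z ^ r :=
    (SemiconjBy.pow_right (show SemiconjBy V (diagonal z) C from hC.symm) r).eq.symm
  have h_diag : C ^ r = V * diagonal (fun j => z j ^ r) * star V := by
    rw [← Pi.pow_def, ← diagonal_pow, ← h_pow, Matrix.mul_assoc, mem_unitaryGroup_iff.1 hV,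
      Matrix.mul_one]
  rw [h_diag, mul_apply]
  simp only [mul_diagonal, star_apply]

theorem norm_det_of_mem_unitaryGroup {V : Matrix (Fin n) (Fin n) ℂ}
    (hV : V ∈ unitaryGroup (Fin n) ℂ) : ‖V.det‖ = 1 :=
  CStarRing.norm_of_mem_unitary (det_of_mem_unitary hV)

theorem det_of_hasSpectralData [NeZero n] {C : Matrix (Fin n) (Fin n) ℂ} {θ μ : Fin n → ℝ}
    (h : HasSpectralData C θ μ) : C.det = ∏ j, Complex.exp (θ j * Complex.I) := by
  obtain ⟨V, hV, hC, -⟩ := h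
  have hV0 : V.det ≠ 0 := norm_ne_zero_iff.1 (norm_det_of_mem_unitaryGroup hV ▸ one_ne_zero)
  have h_det := congrArg det hC
  rw [det_mul, det_mul, det_diagonal, mul_comm] at h_det
  exact mul_left_cancel₀ hV0 h_det

theorem moment_of_hasSpectralData [NeZero n] {α : Fin n → ℂ} {θ μ : Fin n → ℝ}
    (h : HasSpectralData (cmv α) θ μ) (r : ℕ) :
    moment α r = ∑ j, (μ j : ℂ) * Complex.exp (θ j * Complex.I) ^ r := by
  obtain ⟨V, hV, hC, hμ⟩ := h
  rw [moment, pow_apply_of_diagonalization hV hC]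
  refine Finset.sum_congr rfl fun j _ => ?_
  rw [hμ, mul_right_comm, Complex.star_def, Complex.mul_conj', Complex.ofReal_pow]

/-- The exponents `0, 1, -1, 2, -2, …`, in the order in which the CMV basis orthonormalises the
powers of `z`. -/
def zigzag (r : ℕ) : ℤ := if Even r then -(r / 2 : ℕ) else (r / 2 + 1 : ℕ)

theorem zigzag_two_mul (t : ℕ) : zigzag (2 * t) = -t := by simp [zigzag]

theorem zigzag_two_mul_add_one (t : ℕ) : zigzag (2 * t + 1) = t + 1 := by
  simp [zigzag, Nat.mul_add_div]

theorem exists_zigzag_eq_add_perm (n : ℕ) :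
    ∃ (σ : Equiv.Perm (Fin n)) (c : ℤ), ∀ r : Fin n, zigzag r = c + (σ r : ℕ) := by
  have h_bound (r : Fin n) :
      0 ≤ zigzag r + ((n - 1) / 2 : ℕ) ∧ zigzag r + ((n - 1) / 2 : ℕ) < n := by
    grind [zigzag]
  have h_inj : Function.Injective fun r : Fin n =>
      (⟨(zigzag r + ((n - 1) / 2 : ℕ)).toNat, by grind⟩ : Fin n) := by
    intro r s h
    have h_eq : zigzag r = zigzag s := by grind
    grind [zigzag]
  refine ⟨.ofBijective _ (Finite.injective_iff_bijective.1 h_inj), -((n - 1) / 2 : ℕ), fun r => ?_⟩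
  simp only [Equiv.ofBijective_apply]
  grind

theorem norm_det_zpow_perm {z : Fin n → ℂ} (hz : ∀ j, ‖z j‖ = 1) (σ : Equiv.Perm (Fin n)) (c : ℤ) :
    ‖(of fun j r : Fin n => z j ^ (c + (σ r : ℕ))).det‖ = ‖(vandermonde z).det‖ := by
  have hz0 (j : Fin n) : z j ≠ 0 := norm_ne_zero_iff.1 (hz j ▸ one_ne_zero)
  have h_mul : (of fun j r : Fin n => z j ^ (c + (σ r : ℕ))) =
      diagonal (fun j => z j ^ c) * (vandermonde z).submatrix id σ := by
    ext j r
    rw [diagonal_mul, submatrix_apply, vandermonde_apply, Matrix.of_apply, zpow_add₀ (hz0 j),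
      zpow_natCast, id]
  have h_sign : ‖((σ.sign : ℤ) : ℂ)‖ = 1 := by
    rcases Int.units_eq_one_or σ.sign with h | h <;> simp [h]
  rw [h_mul, det_mul, det_diagonal, det_permute', norm_mul, norm_mul, norm_prod, h_sign, one_mul,
    Finset.prod_eq_one fun j _ => by rw [norm_zpow, hz, _root_.one_zpow], one_mul]

theorem norm_det_zpow_zigzag {z : Fin n → ℂ} (hz : ∀ j, ‖z j‖ = 1) :
    ‖(of fun j r : Fin n => z j ^ zigzag r).det‖ = ‖(vandermonde z).det‖ := by
  obtain ⟨σ, c, h⟩ := exists_zigzag_eq_add_perm n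
  simp only [h, norm_det_zpow_perm hz]

variable [NeZero n] {α : Fin n → ℂ}

/-- The matrix whose columns are the vectors of `krylov`, conjugated for even index: its columns
are then `C^{zigzag r} e₀`, as `C` is unitary. -/
def krylovMatrix (α : Fin n → ℂ) : Matrix (Fin n) (Fin n) ℂ :=
  of fun i r => if Even r.val then star (krylov α r i) else krylov α r i

theorem norm_det_krylovMatrix (α : Fin n → ℂ) :
    ‖(krylovMatrix α).det‖ = ∏ i, ‖rhoProd α i‖ := by
  have h_tri : (krylovMatrix α).IsUpperTriangular := fun i r hri => by
    simp [krylovMatrix, krylov_eq_zero (α := α) (show r.val < i.val from hri)]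
  rw [det_of_isUpperTriangular h_tri, norm_prod]
  refine Finset.prod_congr rfl fun i _ => ?_
  rw [krylovMatrix, Matrix.of_apply, krylov_self]
  split_ifs <;> simp

theorem krylovMatrix_eq {V : Matrix (Fin n) (Fin n) ℂ} {z : Fin n → ℂ} (hz : ∀ j, ‖z j‖ = 1)
    (hV : V ∈ unitaryGroup (Fin n) ℂ) (hC : cmv α * V = V * diagonal z) :
    krylovMatrix α =
      V * diagonal (fun j => star (V 0 j)) * of fun j r : Fin n => z j ^ zigzag r := by
  ext i r
  rw [mul_apply]
  simp only [mul_diagonal, Matrix.of_apply, krylovMatrix]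
  obtain ⟨t, hr | hr⟩ := Nat.even_or_odd' r.val
  · have h_inv (j : Fin n) : star (z j ^ t) = z j ^ (-t : ℤ) := by
      rw [_root_.zpow_neg, zpow_natCast, star_pow, Complex.star_def, ← Complex.inv_eq_conj (hz j),
        inv_pow]
    rw [if_pos (hr ▸ even_two_mul t), hr, krylov_even, ← transpose_pow, mulVec_single_one,
      col_apply, transpose_apply, pow_apply_of_diagonalization hV hC, star_sum]
    simp only [star_mul, star_star, h_inv, zigzag_two_mul]
    exact Finset.sum_congr rfl fun j _ => by ring
  · rw [if_neg (by simp [hr]), hr, krylov_odd, mulVec_single_one, col_apply,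
      pow_apply_of_diagonalization hV hC]
    simp only [zigzag_two_mul_add_one]
    exact Finset.sum_congr rfl fun j _ => by rw [← zpow_natCast, Nat.cast_succ]; ring

theorem prod_rhoProd_sq {θ μ : Fin n → ℝ} (h : HasSpectralData (cmv α) θ μ) :
    ∏ i, rhoProd α i ^ 2 =
      (∏ j, μ j) * ‖(vandermonde fun j => Complex.exp (θ j * Complex.I)).det‖ ^ 2 := by
  obtain ⟨V, hV, hC, hμ⟩ := h
  have hz (j : Fin n) := Complex.norm_exp_ofReal_mul_I (θ j)
  have h_det := norm_det_krylovMatrix α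
  rw [krylovMatrix_eq hz hV hC, det_mul, det_mul, det_diagonal, norm_mul, norm_mul,
    norm_det_of_mem_unitaryGroup hV, norm_det_zpow_zigzag hz, one_mul, norm_prod] at h_det
  simp only [hμ, Finset.prod_pow, ← mul_pow]
  rw [← sq_abs, Finset.abs_prod]
  simp only [norm_star] at h_det
  simp only [h_det, Real.norm_eq_abs]

end SpectralData

section SzegoStep

variable {ι : Type*} [Fintype ι] {ζ f : ι → ℂ}

theorem star_mul_dotProduct_mul (hζ : star ζ * ζ = 1) (v w : ι → ℂ) :
    star (ζ * v) ⬝ᵥ (ζ * w) = star v ⬝ᵥ w := by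
  refine Finset.sum_congr rfl fun j _ => ?_
  have hζj : star (ζ j) * ζ j = 1 := congrFun hζ j
  simp only [Pi.star_apply, Pi.mul_apply, star_mul']
  linear_combination star (v j) * w j * hζj

/-- The coefficient of the projection of `ζ f` to `conj f`, for a function `f` of norm `1`. -/
def reflectionCoeff (ζ f : ι → ℂ) : ℂ := (ζ * f) ⬝ᵥ f

/-- The part of `ζ f` that is orthogonal to `conj f`. -/
def szegoResidual (ζ f : ι → ℂ) : ι → ℂ := ζ * f - reflectionCoeff ζ f • star f

/-- One step of the Szegő recursion: the normalised residual. -/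
def szegoStep (ζ f : ι → ℂ) : ι → ℂ := (rho (reflectionCoeff ζ f) : ℂ)⁻¹ • szegoResidual ζ f

theorem dotProduct_szegoResidual (hf : star f ⬝ᵥ f = 1) : f ⬝ᵥ szegoResidual ζ f = 0 := by
  rw [szegoResidual, dotProduct_sub, dotProduct_smul, dotProduct_comm f (star f), hf,
    dotProduct_comm, ← reflectionCoeff, smul_eq_mul, mul_one, sub_self]

theorem star_szegoResidual_dotProduct (hζ : star ζ * ζ = 1) (hf : star f ⬝ᵥ f = 1) :
    star (szegoResidual ζ f) ⬝ᵥ szegoResidual ζ f =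
      ((1 - ‖reflectionCoeff ζ f‖ ^ 2 : ℝ) : ℂ) := by
  have h_star : star (ζ * f) ⬝ᵥ star f = star (reflectionCoeff ζ f) := by
    rw [reflectionCoeff, star_dotProduct_star, dotProduct_comm]
  have h_orth := dotProduct_szegoResidual (ζ := ζ) hf
  nth_rw 1 [szegoResidual]
  rw [star_sub, sub_dotProduct, star_smul, star_star, smul_dotProduct, h_orth, szegoResidual,
    dotProduct_sub, star_mul_dotProduct_mul hζ, hf, dotProduct_smul, h_star, smul_eq_mul,
    Complex.star_def, Complex.mul_conj']
  simp

open ComplexOrder in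
theorem norm_reflectionCoeff_lt_one (hζ : star ζ * ζ = 1) (hf : star f ⬝ᵥ f = 1)
    (h : szegoResidual ζ f ≠ 0) : ‖reflectionCoeff ζ f‖ < 1 := by
  have h_pos := dotProduct_star_self_pos_iff.2 h
  rw [star_szegoResidual_dotProduct hζ hf, Complex.zero_lt_real] at h_pos
  nlinarith [norm_nonneg (reflectionCoeff ζ f)]

theorem norm_reflectionCoeff_eq_one (hζ : star ζ * ζ = 1) (hf : star f ⬝ᵥ f = 1)
    (h : szegoResidual ζ f = 0) : ‖reflectionCoeff ζ f‖ = 1 := by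
  have h_zero := star_szegoResidual_dotProduct hζ hf
  rw [h, dotProduct_zero, eq_comm, Complex.ofReal_eq_zero, sub_eq_zero, eq_comm] at h_zero
  exact (pow_eq_one_iff_of_nonneg (norm_nonneg _) two_ne_zero).1 h_zero

theorem rho_smul_szegoStep (h : ‖reflectionCoeff ζ f‖ < 1) :
    (rho (reflectionCoeff ζ f) : ℂ) • szegoStep ζ f = szegoResidual ζ f :=
  smul_inv_smul₀ (rho_ne_zero h) _

theorem szegoStep_normalized (hζ : star ζ * ζ = 1) (hf : star f ⬝ᵥ f = 1)
    (h : ‖reflectionCoeff ζ f‖ < 1) : star (szegoStep ζ f) ⬝ᵥ szegoStep ζ f = 1 := by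
  have h_rho := rho_ne_zero h
  rw [szegoStep, star_smul, smul_dotProduct, dotProduct_smul, star_szegoResidual_dotProduct hζ hf,
    ← rho_sq h.le, star_inv₀, star_rho, smul_eq_mul, smul_eq_mul, Complex.ofReal_pow]
  field_simp

theorem mul_eq_szegoStep (h : ‖reflectionCoeff ζ f‖ < 1) :
    ζ * f = reflectionCoeff ζ f • star f + (rho (reflectionCoeff ζ f) : ℂ) • szegoStep ζ f := by
  rw [rho_smul_szegoStep h, szegoResidual, add_sub_cancel]

theorem star_eq_szegoStep (hζ : star ζ * ζ = 1) (h : ‖reflectionCoeff ζ f‖ < 1) :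
    star f = ζ * (star (reflectionCoeff ζ f) • f +
      (rho (reflectionCoeff ζ f) : ℂ) • star (szegoStep ζ f)) := by
  ext j
  have h_star := congrArg star (congrFun (rho_smul_szegoStep h) j)
  have hζj : star (ζ j) * ζ j = 1 := congrFun hζ j
  simp only [szegoResidual, Pi.mul_apply, Pi.add_apply, Pi.sub_apply, Pi.smul_apply, Pi.star_apply,
    smul_eq_mul, star_mul', star_sub, star_star, star_rho] at h_star ⊢
  linear_combination -ζ j * h_star - star (f j) * hζj

theorem mul_star_szegoStep (hζ : star ζ * ζ = 1) (h : ‖reflectionCoeff ζ f‖ < 1) :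
    ζ * star (szegoStep ζ f) = (rho (reflectionCoeff ζ f) : ℂ) • star f -
      star (reflectionCoeff ζ f) • szegoStep ζ f := by
  ext j
  have h_mul := congrFun (mul_eq_szegoStep h) j
  have h_star := congrFun (star_eq_szegoStep hζ h) j
  simp only [Pi.mul_apply, Pi.add_apply, Pi.sub_apply, Pi.smul_apply, Pi.star_apply,
    smul_eq_mul] at h_mul h_star ⊢
  refine mul_left_cancel₀ (rho_ne_zero h) ?_
  linear_combination -h_star - star (reflectionCoeff ζ f) * h_mul - star (f j) * ofReal_rho_sq h.le

theorem szegoStep_eq_mul (hζ : star ζ * ζ = 1) (h : ‖reflectionCoeff ζ f‖ < 1) :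
    szegoStep ζ f = ζ * ((rho (reflectionCoeff ζ f) : ℂ) • f -
      reflectionCoeff ζ f • star (szegoStep ζ f)) := by
  ext j
  have h_mul := congrFun (mul_eq_szegoStep h) j
  have h_star := congrFun (mul_star_szegoStep hζ h) j
  simp only [Pi.mul_apply, Pi.add_apply, Pi.sub_apply, Pi.smul_apply, Pi.star_apply,
    smul_eq_mul] at h_mul h_star ⊢
  linear_combination -(rho (reflectionCoeff ζ f) : ℂ) * h_mul + reflectionCoeff ζ f * h_star -
    szegoStep ζ f j * ofReal_rho_sq h.le

end SzegoStep

section Szego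

variable {ι : Type*} {z s : ι → ℂ}

/-- The multiplier of step `k` of the Szegő recursion: `z` in even steps, `1` in odd steps. -/
def twist (z : ι → ℂ) (k : ℕ) : ι → ℂ := if Even k then z else 1

theorem star_twist_mul (hz : star z * z = 1) (k : ℕ) : star (twist z k) * twist z k = 1 := by
  rw [twist]
  split_ifs <;> simp [hz]

theorem twist_congr {i k : ℕ} (h : Even (i + k)) : twist z i = twist z k := by
  rw [twist, twist, if_congr (Nat.even_add.1 h) rfl rfl]

theorem twist_mul_pow (z : ι → ℂ) (k : ℕ) : twist z k * z ^ ((k + 1) / 2) = z ^ (k / 2 + 1) := by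
  obtain ⟨t, rfl | rfl⟩ := Nat.even_or_odd' k
  · simp [twist, pow_succ', Nat.mul_add_div]
  · simp [twist, Nat.mul_add_div, show 2 * t + 1 + 1 = 2 * (t + 1) by ring]

variable [Fintype ι]

/-- Up to conjugation, the orthonormalisation of `1, z, z⁻¹, z², …` in `L²` of a measure on the
points `z j` with masses `s j ^ 2`. The functions are multiplied by `s`, so that the inner product
is the one of `ℂ^ι`. -/
def szego (z s : ι → ℂ) : ℕ → ι → ℂ
  | 0 => s
  | k + 1 => szegoStep (twist z k) (szego z s k)

/-- The reflection coefficients of the Szegő recursion: the conjugates of the Verblunsky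
coefficients. -/
def szegoCoeff (z s : ι → ℂ) (k : ℕ) : ℂ := reflectionCoeff (twist z k) (szego z s k)

theorem szego_normalized (hz : star z * z = 1) (hs : star s ⬝ᵥ s = 1) {k : ℕ}
    (h : ∀ l < k, ‖szegoCoeff z s l‖ < 1) : star (szego z s k) ⬝ᵥ szego z s k = 1 := by
  induction k with
  | zero => exact hs
  | succ k ih =>
    exact szegoStep_normalized (star_twist_mul hz k) (ih fun l hl => h l (hl.trans k.lt_succ_self))
      (h k k.lt_succ_self)

section Polynomial

open Polynomial

/-- The monic orthogonal polynomial `Φ_k` with reflection coefficients `a`, and its reversal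
`Φ_k^*`. -/
def szegoPoly (a : ℕ → ℂ) : ℕ → ℂ[X] × ℂ[X]
  | 0 => (1, 1)
  | k + 1 =>
    (X * (szegoPoly a k).1 - C (a k) * (szegoPoly a k).2,
      (szegoPoly a k).2 - C (star (a k)) * (X * (szegoPoly a k).1))

theorem szegoPoly_monic_and_natDegree (a : ℕ → ℂ) (k : ℕ) :
    (szegoPoly a k).1.Monic ∧ (szegoPoly a k).1.natDegree = k ∧
      (szegoPoly a k).2.natDegree ≤ k := by
  induction k with
  | zero => simp [szegoPoly]
  | succ k ih =>
    obtain ⟨h_monic, h_deg, h_deg'⟩ := ih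
    have h_X : (X * (szegoPoly a k).1).natDegree = k + 1 := by
      rw [natDegree_X_mul h_monic.ne_zero, h_deg]
    have h_lt : (C (a k) * (szegoPoly a k).2).natDegree < (X * (szegoPoly a k).1).natDegree :=
      ((natDegree_C_mul_le _ _).trans h_deg').trans_lt (h_X ▸ k.lt_succ_self)
    refine ⟨(monic_X.mul h_monic).sub_of_left (degree_lt_degree h_lt), ?_, ?_⟩
    · rw [szegoPoly, natDegree_sub_eq_left_of_natDegree_lt h_lt, h_X]
    · exact (natDegree_sub_le _ _).trans
        (max_le (h_deg'.trans k.le_succ) ((natDegree_C_mul_le _ _).trans h_X.le))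

theorem szegoResidual_mul_pow {c : ℂ} {k : ℕ} {j : ι}
    (h : c * szego z s k j * z j ^ (k / 2) = s j * (szegoPoly (szegoCoeff z s) k).1.eval (z j))
    (h' : c * star (szego z s k j) * z j ^ ((k + 1) / 2) =
      s j * (szegoPoly (szegoCoeff z s) k).2.eval (z j)) :
    c * szegoResidual (twist z k) (szego z s k) j * z j ^ ((k + 1) / 2) =
      s j * (szegoPoly (szegoCoeff z s) (k + 1)).1.eval (z j) := by
  have h_twist := congrFun (twist_mul_pow z k) j
  simp only [Pi.mul_apply, Pi.pow_apply] at h_twist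
  simp only [szegoResidual, szegoPoly, szegoCoeff, Pi.sub_apply, Pi.mul_apply, Pi.smul_apply,
    Pi.star_apply, smul_eq_mul, eval_sub, eval_mul, eval_X, eval_C]
  linear_combination z j * h - reflectionCoeff (twist z k) (szego z s k) * h' +
    c * szego z s k j * h_twist

theorem szego_mul_pow (hs : star s = s) (hz : star z * z = 1) {k : ℕ}
    (h : ∀ l < k, ‖szegoCoeff z s l‖ < 1) (j : ι) :
    (∏ l ∈ Finset.range k, (rho (szegoCoeff z s l) : ℂ)) * szego z s k j * z j ^ (k / 2) =
        s j * (szegoPoly (szegoCoeff z s) k).1.eval (z j) ∧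
      (∏ l ∈ Finset.range k, (rho (szegoCoeff z s l) : ℂ)) * star (szego z s k j) *
          z j ^ ((k + 1) / 2) = s j * (szegoPoly (szegoCoeff z s) k).2.eval (z j) := by
  induction k with
  | zero =>
    have hsj : star (s j) = s j := congrFun hs j
    simpa [szego, szegoPoly] using hsj
  | succ k ih =>
    obtain ⟨h_eval, h_eval'⟩ := ih fun l hl => h l (hl.trans k.lt_succ_self)
    have h_rho := congrFun (rho_smul_szegoStep (h k k.lt_succ_self)) j
    have h_star := congrFun (star_eq_szegoStep (star_twist_mul hz k) (h k k.lt_succ_self)) j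
    have h_twist := congrFun (twist_mul_pow z k) j
    simp only [Pi.smul_apply, Pi.mul_apply, Pi.add_apply, Pi.star_apply,
      Pi.pow_apply, smul_eq_mul] at h_rho h_star h_twist
    rw [← szegoCoeff] at h_star
    rw [Finset.prod_range_succ]
    constructor
    · rw [← szegoResidual_mul_pow h_eval h_eval', ← h_rho]
      simp only [szego, szegoCoeff]
      ring
    · rw [show (k + 1 + 1) / 2 = k / 2 + 1 by omega]
      simp only [szegoPoly, szego, eval_sub, eval_mul, eval_X, eval_C]
      linear_combination h_eval' - star (szegoCoeff z s k) * z j * h_eval -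
        (∏ l ∈ Finset.range k, (rho (szegoCoeff z s l) : ℂ)) * (z j ^ ((k + 1) / 2) * h_star +
          (star (szegoCoeff z s k) * szego z s k j + rho (szegoCoeff z s k) *
            star (szegoStep (twist z k) (szego z s k) j)) * h_twist)

theorem norm_szegoCoeff_lt_one (hs : star s = s) (hs0 : ∀ j, s j ≠ 0) (hs1 : star s ⬝ᵥ s = 1)
    (hz : star z * z = 1) (hinj : Function.Injective z) {k : ℕ} (hk : k + 1 < Fintype.card ι) :
    ‖szegoCoeff z s k‖ < 1 := by
  induction k using Nat.strong_induction_on with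
  | _ k ih =>
    have h_lt (l : ℕ) (hl : l < k) : ‖szegoCoeff z s l‖ < 1 := ih l hl (by omega)
    obtain ⟨h_monic, h_deg, -⟩ := szegoPoly_monic_and_natDegree (szegoCoeff z s) (k + 1)
    refine norm_reflectionCoeff_lt_one (star_twist_mul hz k) (szego_normalized hz hs1 h_lt) ?_
    intro h_zero
    refine h_monic.ne_zero (eq_zero_of_natDegree_lt_card_of_eval_eq_zero _ hinj (fun j => ?_)
      (h_deg.trans_lt hk))
    obtain ⟨h_eval, h_eval'⟩ := szego_mul_pow hs hz h_lt j
    refine mul_left_cancel₀ (hs0 j) ?_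
    rw [← szegoResidual_mul_pow h_eval h_eval', h_zero, Pi.zero_apply, mul_zero, mul_zero, zero_mul]

end Polynomial

/-- `f_i` or its conjugate, where `f_i = szego z s i`, according to the parity of `i + k`. -/
def szegoAlign (z s : ι → ℂ) (k i : ℕ) : ι → ℂ := star^[i + k] (szego z s i)

theorem szegoAlign_of_even {k i : ℕ} (h : Even (i + k)) : szegoAlign z s k i = szego z s i := by
  rw [szegoAlign, star_involutive.iterate_even h, id]

theorem szegoAlign_of_not_even {k i : ℕ} (h : ¬ Even (i + k)) :
    szegoAlign z s k i = star (szego z s i) := by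
  rw [szegoAlign, star_involutive.iterate_odd (Nat.not_even_iff_odd.1 h)]

theorem szegoAlign_succ (k i : ℕ) : szegoAlign z s (k + 1) i = star (szegoAlign z s k i) :=
  Function.iterate_succ_apply' _ _ _

theorem star_szegoAlign_mem_mul_span (hs : star s = s) (hz : star z * z = 1) {i k : ℕ}
    (hik : i < k) (h : ∀ l < k, ‖szegoCoeff z s l‖ < 1) :
    ∃ v ∈ Submodule.span ℂ (szegoAlign z s k '' Set.Iio k),
      star (szegoAlign z s k i) = twist z k * v := by
  have h_mem {l : ℕ} (hl : l < k) :
      szegoAlign z s k l ∈ Submodule.span ℂ (szegoAlign z s k '' Set.Iio k) :=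
    Submodule.subset_span ⟨l, hl, rfl⟩
  have h_comb {l : ℕ} (hl : l + 1 < k) (b d : ℂ) :=
    add_mem (Submodule.smul_mem _ b (h_mem (l.lt_succ_self.trans hl)))
      (Submodule.smul_mem _ d (h_mem hl))
  by_cases he : Even (i + k)
  · have ho : ¬ Even (i + 1 + k) := by grind
    refine ⟨_, h_comb (l := i) (by grind) (star (szegoCoeff z s i)) (rho (szegoCoeff z s i)), ?_⟩
    rw [szegoAlign_of_even he, szegoAlign_of_not_even ho, ← twist_congr he]
    exact star_eq_szegoStep (star_twist_mul hz i) (h i hik)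
  · obtain _ | l := i
    · have hk : ¬ Even k := by simpa using he
      refine ⟨_, h_mem hik, ?_⟩
      rw [szegoAlign_of_not_even he, star_star, szego, hs, twist, if_neg hk, one_mul]
    · have hl : Even (l + k) := by grind
      refine ⟨_, h_comb (l := l) hik (rho (szegoCoeff z s l)) (-szegoCoeff z s l), ?_⟩
      rw [szegoAlign_of_not_even he, szegoAlign_of_even hl, star_star, ← twist_congr hl, neg_smul,
        ← sub_eq_add_neg]
      exact szegoStep_eq_mul (star_twist_mul hz l) (h l (by omega))

theorem szegoAlign_dotProduct_residual (hs : star s = s) (hs1 : star s ⬝ᵥ s = 1)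
    (hz : star z * z = 1) {k : ℕ} (h : ∀ l < k, ‖szegoCoeff z s l‖ < 1)
    (h_orth : ∀ i < k, star (szegoAlign z s k i) ⬝ᵥ szego z s k = 0) {i : ℕ} (hi : i ≤ k) :
    szegoAlign z s k i ⬝ᵥ szegoResidual (twist z k) (szego z s k) = 0 := by
  rcases hi.lt_or_eq with hi | rfl
  · obtain ⟨v, hv, h_star⟩ := star_szegoAlign_mem_mul_span hs hz hi h
    have h_span : star v ⬝ᵥ szego z s k = 0 := by
      clear h_star
      induction hv using Submodule.span_induction with
      | mem _ hv => obtain ⟨l, hl, rfl⟩ := hv; exact h_orth l hl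
      | zero => simp
      | add _ _ _ _ hv hw => simp [hv, hw]
      | smul _ _ _ hv => simp [hv]
    have h_mul : szegoAlign z s k i ⬝ᵥ (twist z k * szego z s k) = 0 := by
      rw [← star_star (szegoAlign z s k i), h_star, star_mul_dotProduct_mul (star_twist_mul hz k),
        h_span]
    have h_star_szego : szegoAlign z s k i ⬝ᵥ star (szego z s k) = 0 := by
      rw [dotProduct_comm, star_dotProduct, h_orth i hi, star_zero]
    rw [szegoResidual, dotProduct_sub, h_mul, dotProduct_smul, h_star_szego, smul_zero, sub_zero]
  · rw [szegoAlign_of_even ⟨i, rfl⟩]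
    exact dotProduct_szegoResidual (szego_normalized hz hs1 h)

theorem star_szegoAlign_dotProduct_szego (hs : star s = s) (hs1 : star s ⬝ᵥ s = 1)
    (hz : star z * z = 1) {k : ℕ} (h : ∀ l < k, ‖szegoCoeff z s l‖ < 1) {i : ℕ} (hi : i < k) :
    star (szegoAlign z s k i) ⬝ᵥ szego z s k = 0 := by
  induction k generalizing i with
  | zero => omega
  | succ k ih =>
    have h_lt (l : ℕ) (hl : l < k) := h l (hl.trans k.lt_succ_self)
    have h_residual := szegoAlign_dotProduct_residual hs hs1 hz h_lt (fun i hi => ih h_lt hi)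
      (Nat.lt_succ_iff.1 hi)
    rw [← rho_smul_szegoStep (h k k.lt_succ_self), dotProduct_smul, smul_eq_mul] at h_residual
    rw [szegoAlign_succ, star_star]
    exact (mul_eq_zero.1 h_residual).resolve_left (rho_ne_zero (h k k.lt_succ_self))

end Szego

section SzegoMatrix

variable {n : ℕ} {z s : Fin n → ℂ}

theorem star_szegoAlign_dotProduct_szegoAlign (hs : star s = s) (hs1 : star s ⬝ᵥ s = 1)
    (hz : star z * z = 1) {l : ℕ} (h : ∀ l' < l, ‖szegoCoeff z s l'‖ < 1) {i : ℕ} (hi : i < l)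
    (k : ℕ) : star (szegoAlign z s k i) ⬝ᵥ szegoAlign z s k l = 0 := by
  have h_orth := star_szegoAlign_dotProduct_szego hs hs1 hz h hi
  by_cases hk : Even (l + k)
  · have h_align : szegoAlign z s k i = szegoAlign z s l i := by
      by_cases hil : Even (i + k)
      · rw [szegoAlign_of_even hil, szegoAlign_of_even (by grind)]
      · rw [szegoAlign_of_not_even hil, szegoAlign_of_not_even (by grind)]
    rw [h_align, szegoAlign_of_even hk, h_orth]
  · have h_align : star (szegoAlign z s k i) = szegoAlign z s l i := by
      by_cases hil : Even (i + k)
      · rw [szegoAlign_of_even hil, szegoAlign_of_not_even (by grind)]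
      · rw [szegoAlign_of_not_even hil, star_star, szegoAlign_of_even (by grind)]
    rw [h_align, szegoAlign_of_not_even hk, dotProduct_comm, star_dotProduct, h_orth, star_zero]

theorem star_szegoAlign_dotProduct_self (hs1 : star s ⬝ᵥ s = 1) (hz : star z * z = 1) {l : ℕ}
    (h : ∀ l' < l, ‖szegoCoeff z s l'‖ < 1) (k : ℕ) :
    star (szegoAlign z s k l) ⬝ᵥ szegoAlign z s k l = 1 := by
  have h_norm := szego_normalized hz hs1 h
  by_cases hk : Even (l + k)
  · rw [szegoAlign_of_even hk, h_norm]
  · rw [szegoAlign_of_not_even hk, star_star, dotProduct_comm, h_norm]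

/-- The matrix with rows `szegoAlign z s k i`; for `k = 0` these form the CMV basis. -/
def szegoMatrix (z s : Fin n → ℂ) (k : ℕ) : Matrix (Fin n) (Fin n) ℂ :=
  of fun i => szegoAlign z s k i

theorem szegoMatrix_mem_unitaryGroup (hs : star s = s) (hs1 : star s ⬝ᵥ s = 1)
    (hz : star z * z = 1) (ha : ∀ k, k + 1 < n → ‖szegoCoeff z s k‖ < 1) (k : ℕ) :
    szegoMatrix z s k ∈ unitaryGroup (Fin n) ℂ := by
  have h_lt (l : Fin n) (l' : ℕ) (hl' : l' < l) : ‖szegoCoeff z s l'‖ < 1 := ha l' (by omega)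
  rw [mem_unitaryGroup_iff]
  ext i l
  change szegoAlign z s k i ⬝ᵥ star (szegoAlign z s k l) = _
  rcases lt_trichotomy i l with hil | rfl | hil
  · rw [one_apply_ne hil.ne, dotProduct_comm, star_dotProduct,
      star_szegoAlign_dotProduct_szegoAlign hs hs1 hz (h_lt l) hil, star_zero]
  · rw [one_apply_eq, dotProduct_comm, star_szegoAlign_dotProduct_self hs1 hz (h_lt i)]
  · rw [one_apply_ne hil.ne', dotProduct_comm,
      star_szegoAlign_dotProduct_szegoAlign hs hs1 hz (h_lt i) hil]

theorem szegoResidual_last (hs : star s = s) (hs1 : star s ⬝ᵥ s = 1) (hz : star z * z = 1)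
    {k : ℕ} (hk : k + 1 = n) (ha : ∀ l < k, ‖szegoCoeff z s l‖ < 1) :
    szegoResidual (twist z k) (szego z s k) = 0 := by
  have h_unitary := szegoMatrix_mem_unitaryGroup hs hs1 hz (fun l hl => ha l (by omega)) k
  have h_orth : szegoMatrix z s k *ᵥ szegoResidual (twist z k) (szego z s k) = 0 :=
    funext fun i => szegoAlign_dotProduct_residual hs hs1 hz ha
      (fun i hi => star_szegoAlign_dotProduct_szego hs hs1 hz ha hi) (by omega)
  rw [← one_mulVec (szegoResidual _ _), ← mem_unitaryGroup_iff'.1 h_unitary, ← mulVec_mulVec,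
    h_orth, mulVec_zero]

theorem factor_mul_szegoMatrix (hs : star s = s) (hs1 : star s ⬝ᵥ s = 1) (hz : star z * z = 1)
    (ha : ∀ k, k + 1 < n → ‖szegoCoeff z s k‖ < 1) (r : ℕ) :
    factor (fun i => star (szegoCoeff z s i)) r * szegoMatrix z s (r + 1) =
      szegoMatrix z s r * diagonal (twist z r) := by
  ext i j
  rw [mul_diagonal, mul_comm]
  change (factor _ r *ᵥ fun l => szegoAlign z s (r + 1) l j) i = (twist z r * szegoAlign z s r i) j
  rcases factor_row_cases r i with ⟨he, l, hl⟩ | ⟨he, hn⟩ | ⟨l, hl, he⟩ | ⟨h0, hr⟩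
  · have h_coeff := ha i (by omega)
    rw [factor_mulVec_top _ hl he, hl, szegoAlign_of_even he, ← twist_congr he,
      szegoAlign_of_not_even (by grind), szegoAlign_of_even (by grind)]
    rw [star_star, rho_star, mul_eq_szegoStep h_coeff]
    rfl
  · have h_residual := szegoResidual_last hs hs1 hz hn fun l hl => ha l (by omega)
    rw [szegoResidual, sub_eq_zero] at h_residual
    rw [factor_mulVec_last _ hn he, szegoAlign_of_even he, ← twist_congr he, h_residual,
      szegoAlign_of_not_even (by grind)]
    simp [szegoCoeff]
  · have h_coeff := ha l (by omega)
    rw [factor_mulVec_bot _ hl he, hl, szegoAlign_of_not_even (k := r) (i := l + 1) (by grind),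
      ← twist_congr he, szegoAlign_of_not_even (by grind), szegoAlign_of_even (by grind)]
    rw [rho_star, szego, mul_star_szegoStep (star_twist_mul hz l) h_coeff]
    rfl
  · rw [factor_mulVec_zero _ h0 hr, h0, szegoAlign_of_even (by grind),
      szegoAlign_of_not_even (by grind), szego, hs, twist, if_neg hr, one_mul]

theorem cmv_mul_szegoMatrix (hs : star s = s) (hs1 : star s ⬝ᵥ s = 1) (hz : star z * z = 1)
    (ha : ∀ k, k + 1 < n → ‖szegoCoeff z s k‖ < 1) :
    cmv (fun i : Fin n => star (szegoCoeff z s i)) * szegoMatrix z s 0 =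
      szegoMatrix z s 0 * diagonal z := by
  have h_period : szegoMatrix z s 2 = szegoMatrix z s 0 := by
    ext i j
    simp only [szegoMatrix, Matrix.of_apply, szegoAlign_succ, star_star]
  have h_L := factor_mul_szegoMatrix hs hs1 hz ha 0
  have h_M := factor_mul_szegoMatrix hs hs1 hz ha 1
  simp only [factor, twist, Nat.not_even_one, Even.zero, if_true, if_false, zero_add,
    one_add_one_eq_two, h_period] at h_L h_M
  rw [cmv, Matrix.mul_assoc, h_M]
  simpa using h_L

theorem exists_hasSpectralData {m : ℕ} {θ μ : Fin (m + 1) → ℝ}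
    (hinj : Function.Injective fun j => Complex.exp (θ j * Complex.I)) (hμ : ∀ j, 0 < μ j)
    (hsum : ∑ j, μ j = 1) :
    ∃ α : Fin (m + 1) → ℂ, (∀ k : Fin m, ‖α k.castSucc‖ < 1) ∧ ‖α (Fin.last m)‖ = 1 ∧
      HasSpectralData (cmv α) θ μ := by
  let z (j : Fin (m + 1)) : ℂ := Complex.exp (θ j * Complex.I)
  let s (j : Fin (m + 1)) : ℂ := Real.sqrt (μ j)
  have hz : star z * z = 1 := funext fun j => by simp [z, Complex.conj_mul']
  have hs : star s = s := funext fun j => Complex.conj_ofReal _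
  have hs0 (j : Fin (m + 1)) : s j ≠ 0 :=
    Complex.ofReal_ne_zero.2 (Real.sqrt_pos.2 (hμ j)).ne'
  have hs1 : star s ⬝ᵥ s = 1 := by
    simp only [hs, dotProduct, s, ← Complex.ofReal_mul, Real.mul_self_sqrt (hμ _).le]
    exact_mod_cast hsum
  have ha (k : ℕ) (hk : k + 1 < m + 1) : ‖szegoCoeff z s k‖ < 1 :=
    norm_szegoCoeff_lt_one hs hs0 hs1 hz hinj (by simpa using hk)
  refine ⟨fun i => star (szegoCoeff z s i), fun k => ?_, ?_, szegoMatrix z s 0,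
    szegoMatrix_mem_unitaryGroup hs hs1 hz ha 0, cmv_mul_szegoMatrix hs hs1 hz ha, fun j => ?_⟩
  · rw [norm_star]
    exact ha k (by simp)
  · rw [norm_star]
    have h_lt (l : ℕ) (hl : l < m) := ha l (by omega)
    exact norm_reflectionCoeff_eq_one (star_twist_mul hz m) (szego_normalized hz hs1 h_lt)
      (szegoResidual_last hs hs1 hz rfl h_lt)
  · simp [szegoMatrix, szegoAlign_of_even, szego, s, abs_of_nonneg, Real.sq_sqrt (hμ j).le]

end SzegoMatrix

section ConfluentVandermonde

section Polynomial

open Polynomial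

variable {ι R : Type*} [CommRing R]

theorem det_of_monic_eq_det_of_X_pow [Fintype ι] [DecidableEq ι] {N : ℕ} (e : ι ≃ Fin N)
    (f : R[X] →ₗ[R] ι → R) {p : ι → R[X]} (h_deg : ∀ i, (p i).natDegree = e i)
    (h_monic : ∀ i, (p i).Monic) :
    (of fun i => f (p i)).det = (of fun i => f (X ^ (e i).val)).det := by
  let A : Matrix (Fin N) (Fin N) R := of fun k l => (p (e.symm l)).coeff k
  have hA : A.det = 1 := det_matrixOfPolynomials _ (by simp [h_deg]) fun _ => h_monic _
  have h_mul : (of fun i => f (p i)) = Aᵀ.submatrix e e * of fun i => f (X ^ (e i).val) := by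
    ext i j
    have h_expand : p i = ∑ k : Fin N, (p i).coeff k • X ^ k.val := by
      rw [Fin.sum_univ_eq_sum_range (fun k => (p i).coeff k • (X ^ k : R[X]))]
      simp only [smul_X_eq_monomial]
      exact as_sum_range' _ _ (by rw [h_deg]; exact (e i).isLt)
    rw [Matrix.of_apply, h_expand, Matrix.mul_apply, ← e.symm.sum_comp]
    simp [A]
  rw [h_mul, det_mul, det_submatrix_equiv_self, det_transpose, hA, one_mul]

/-- The values `v j * p'(v j)` of the Euler derivative of a polynomial at the nodes `v`, followed by
the values of the polynomial. -/
def eulerEval (v : ι → R) : R[X] →ₗ[R] ι ⊕ ι → R :=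
  LinearMap.pi (Sum.elim (fun j => v j • leval (v j) ∘ₗ derivative) fun j => leval (v j))

theorem eulerEval_inl (v : ι → R) (p : R[X]) (j : ι) :
    eulerEval v p (.inl j) = v j * (derivative p).eval (v j) := rfl

theorem eulerEval_inr (v : ι → R) (p : R[X]) (j : ι) :
    eulerEval v p (.inr j) = p.eval (v j) := rfl

theorem eulerEval_X_pow_inl (v : ι → R) (d : ℕ) (j : ι) :
    eulerEval v (X ^ d) (.inl j) = d * v j ^ d := by
  rw [eulerEval_inl, derivative_X_pow]
  cases d with
  | zero => simp
  | succ d => simp [pow_succ]; ring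

theorem det_eulerEval_X_pow {n : ℕ} (v : Fin n → R) (σ : Equiv.Perm (Fin n)) :
    (of fun i => eulerEval v (X ^ Sum.elim (fun t => t.val + n) (fun s => (σ s).val) i)).det =
      (∏ j, v j * ∏ i ∈ Finset.univ.erase j, (v j - v i)) * (vandermonde v).det *
        (of fun s j => v j ^ (σ s).val).det := by
  nontriviality R
  let N := Lagrange.nodal Finset.univ v
  let p : Fin n ⊕ Fin n → R[X] := Sum.elim (fun t => N * X ^ t.val) fun s => X ^ (σ s).val
  let e : Fin n ⊕ Fin n ≃ Fin (n + n) :=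
    ((Equiv.refl _).sumCongr σ).trans ((Equiv.sumComm _ _).trans finSumFinEquiv)
  have hN : N.Monic := Lagrange.nodal_monic
  have h_deg (i) : (p i).natDegree = e i := by
    rcases i with t | s
    · simp [p, e, hN.natDegree_mul (monic_X_pow _), N, Lagrange.natDegree_nodal, add_comm]
    · simp [p, e]
  have h_monic (i) : (p i).Monic := by
    rcases i with t | s
    · exact hN.mul (monic_X_pow _)
    · exact monic_X_pow _
  have h_exp (i) : (e i).val = Sum.elim (fun t => t.val + n) (fun s => (σ s).val) i := by
    rcases i with t | s <;> simp [e, add_comm]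
  have h_blocks : (of fun i => eulerEval v (p i)) = fromBlocks
      (of fun t j => (v j * ∏ i ∈ Finset.univ.erase j, (v j - v i)) * (vandermonde v)ᵀ t j) 0
      (of fun s j => (σ s).val * v j ^ (σ s).val) (of fun s j => v j ^ (σ s).val) := by
    ext (t | s) (j | j)
    · simp [p, eulerEval_inl, N, Lagrange.eval_nodal_at_node,
        Lagrange.eval_nodal_derivative_eval_node_eq, Lagrange.eval_nodal, mul_assoc]
    · simp [p, eulerEval_inr, N, Lagrange.eval_nodal_at_node]
    · exact eulerEval_X_pow_inl v _ j
    · simp [p, eulerEval_inr]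
  simp only [← h_exp]
  rw [← det_of_monic_eq_det_of_X_pow e _ h_deg h_monic, h_blocks, det_fromBlocks_zero₁₂,
    det_mul_row, det_transpose]

end Polynomial

variable {ι κ K : Type*} [Field K]

/-- The confluent Vandermonde matrix with double nodes `v` and exponents `e`, which may be
negative: the row of an exponent consists of the values `e * w ^ e` of the Euler derivative of
`w ↦ w ^ e` at the nodes, followed by the values of `w ↦ w ^ e`. -/
def confluent (e : κ → ℤ) (v : ι → K) : Matrix κ (ι ⊕ ι) K :=
  of fun i => Sum.elim (fun j => e i * v j ^ e i) fun j => v j ^ e i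

theorem confluent_natCast (d : κ → ℕ) (v : ι → K) :
    confluent (fun i => (d i : ℤ)) v = of fun i => eulerEval v (Polynomial.X ^ d i) := by
  ext i (j | j)
  · simp [confluent, eulerEval_X_pow_inl]
  · simp [confluent, eulerEval_inr]

theorem det_confluent_add [Fintype ι] [DecidableEq ι] (e : ι ⊕ ι → ℤ) (c : ℤ) {v : ι → K}
    (hv : ∀ j, v j ≠ 0) :
    (confluent (fun i => e i + c) v).det = (confluent e v).det * (∏ j, v j ^ c) ^ 2 := by
  have h_mul : confluent (fun i => e i + c) v = confluent e v *
      fromBlocks (diagonal fun j => v j ^ c) 0 (diagonal fun j => c * v j ^ c)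
        (diagonal fun j => v j ^ c) := by
    ext i (j | j)
    · simp [confluent, Matrix.mul_apply, diagonal_apply, zpow_add₀ (hv j)]
      ring
    · simp [confluent, Matrix.mul_apply, diagonal_apply, zpow_add₀ (hv j)]
  rw [h_mul, det_mul, det_fromBlocks_zero₁₂, det_diagonal, pow_two]

/-- The exponents `1, …, n, -1, …, -(n - 1), 0`, where `n = m + 1`. -/
def laurentExponent (m : ℕ) : Fin (m + 1) ⊕ Fin (m + 1) → ℤ :=
  Sum.elim (fun t => (t : ℤ) + 1) fun s => -(finRotate (m + 1) s : ℤ)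

variable {m n : ℕ}

theorem prod_one_sub_div {z : Fin n → ℂ} (hz : ∀ j, ‖z j‖ = 1) :
    ∏ j, ∏ i ∈ Finset.univ.erase j, (1 - z i / z j) = (‖(vandermonde z).det‖ : ℂ) ^ 2 := by
  have h_compl (j : Fin n) : Finset.univ.erase j = {j}ᶜ := by ext; simp
  have h_pair (i j : Fin n) : (1 - z i / z j) * (1 - z j / z i) = (‖z i - z j‖ : ℂ) ^ 2 := by
    have h_ne (k : Fin n) : z k ≠ 0 := norm_ne_zero_iff.1 (by simp [hz k])
    have hi := h_ne i
    have hj := h_ne j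
    rw [← Complex.conj_mul', map_sub, ← Complex.inv_eq_conj (hz i), ← Complex.inv_eq_conj (hz j)]
    field_simp
  simp only [h_compl, det_vandermonde, norm_prod, Complex.ofReal_prod, ← Finset.prod_pow]
  rw [← Finset.prod_prod_Ioi_mul_eq_prod_prod_off_diag fun i j => 1 - z i / z j]
  simp only [h_pair]

theorem prod_mul_sub_of_norm_eq_one {z : Fin (m + 1) → ℂ} (hz : ∀ j, ‖z j‖ = 1) :
    ∏ j, z j * ∏ i ∈ Finset.univ.erase j, (z j - z i) =
      (∏ j, z j) ^ (m + 1) * (‖(vandermonde z).det‖ : ℂ) ^ 2 := by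
  rw [← prod_one_sub_div hz, ← Finset.prod_pow, ← Finset.prod_mul_distrib]
  refine Finset.prod_congr rfl fun j _ => ?_
  have hj : z j ≠ 0 := norm_ne_zero_iff.1 (by simp [hz j])
  have h_card : z j ^ m = ∏ _i ∈ Finset.univ.erase j, z j := by
    rw [Finset.prod_const, Finset.card_erase_of_mem (Finset.mem_univ j), Finset.card_fin,
      Nat.add_sub_cancel]
  rw [pow_succ', mul_assoc, h_card, ← Finset.prod_mul_distrib]
  simp only [mul_sub, mul_one, mul_div_cancel₀ _ hj]

theorem det_rev_finRotate_pow {z : Fin (m + 1) → ℂ} (hz : ∀ j, ‖z j‖ = 1) :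
    (of fun s j => z j ^ (finRotate (m + 1) s).rev.val).det =
      (∏ j, z j) ^ m * ((-1) ^ m * star (vandermonde z).det) := by
  have h_mul : (of fun s j => z j ^ (finRotate (m + 1) s).rev.val) =
      of fun s j => z j ^ m * (vandermonde z)ᴴ.submatrix (finRotate (m + 1)) id s j := by
    ext s j
    have h_unit : z j * star (z j) = 1 := by simp [Complex.mul_conj', hz j]
    simp only [Matrix.of_apply, submatrix_apply, id, conjTranspose_apply, vandermonde_apply,
      star_pow]
    generalize finRotate (m + 1) s = t
    have h_pow : z j ^ m = z j ^ t.rev.val * z j ^ t.val := by rw [← pow_add]; congr 1; grind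
    rw [h_pow, mul_assoc, ← mul_pow, h_unit, one_pow, mul_one]
  rw [h_mul, det_mul_row, Finset.prod_pow, det_permute, sign_finRotate, det_conjTranspose]
  simp

theorem det_confluent_laurentExponent {z : Fin (m + 1) → ℂ} (hz : ∀ j, ‖z j‖ = 1) :
    (confluent (laurentExponent m) z).det =
      (-1) ^ m * ((‖(vandermonde z).det‖ : ℂ) ^ 4 * ∏ j, z j) := by
  have hz0 (j : Fin (m + 1)) : z j ≠ 0 := norm_ne_zero_iff.1 (by simp [hz j])
  let σ : Equiv.Perm (Fin (m + 1)) := (finRotate (m + 1)).trans Fin.revPerm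
  have h_exp : (fun i => laurentExponent m i + m) = fun i =>
      ((Sum.elim (fun t : Fin (m + 1) => t.val + (m + 1)) (fun s => (σ s).val) i : ℕ) : ℤ) := by
    ext (t | s)
    · simp [laurentExponent]
      ring
    · simp only [laurentExponent, σ, Sum.elim_inr, Equiv.trans_apply, Fin.revPerm_apply]
      generalize finRotate (m + 1) s = t
      grind
  have h_shift := det_confluent_add (laurentExponent m) m hz0
  have h_norm : star (vandermonde z).det * (vandermonde z).det = (‖(vandermonde z).det‖ : ℂ) ^ 2 :=
    Complex.conj_mul' _
  rw [h_exp, confluent_natCast, det_eulerEval_X_pow, prod_mul_sub_of_norm_eq_one hz] at h_shift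
  simp only [σ, Equiv.trans_apply, Fin.revPerm_apply, det_rev_finRotate_pow hz, zpow_natCast,
    Finset.prod_pow] at h_shift
  have h_ne : (∏ j, z j) ^ m ≠ 0 := pow_ne_zero _ (Finset.prod_ne_zero_iff.2 fun j _ => hz0 j)
  refine mul_right_cancel₀ (pow_ne_zero 2 h_ne) (h_shift.symm.trans ?_)
  linear_combination (∏ j, z j) ^ (m + 1) * (‖(vandermonde z).det‖ : ℂ) ^ 2 * (∏ j, z j) ^ m *
    (-1) ^ m * h_norm

end ConfluentVandermonde

section LinearAlgebra

variable {ι κ R : Type*} [Fintype ι] [DecidableEq ι] [CommRing R]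

theorem det_of_lower_triangular_of_injective {A : Matrix ι ι R} {b : ι → ℕ}
    (hb : Function.Injective b) (h : ∀ i j, b i < b j → A i j = 0) : A.det = ∏ i, A i i := by
  let _ : LinearOrder ι := LinearOrder.lift' b hb
  convert det_of_isLowerTriangular A h

theorem det_add_mul_inl_col [Fintype κ] [DecidableEq κ] (A : Matrix (ι ⊕ κ) (ι ⊕ κ) R)
    (f : κ → ι) (c : R) :
    (of fun i => Sum.elim (fun j => A i (.inl j)) fun k =>
      A i (.inr k) + c * A i (.inl (f k))).det = A.det := by
  have h_mul : (of fun i => Sum.elim (fun j => A i (.inl j)) fun k =>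
      A i (.inr k) + c * A i (.inl (f k))) =
      A * fromBlocks 1 (of fun j k => if j = f k then c else 0) 0 1 := by
    ext i (j | k) <;> simp [Matrix.mul_apply, Matrix.one_apply, add_comm, mul_comm]
  rw [h_mul, det_mul, det_fromBlocks_zero₂₁, det_one, det_one, mul_one, mul_one]

end LinearAlgebra

section ComplexJacobian

variable {ι κ E : Type*} [NormedAddCommGroup E] [NormedSpace ℝ E] {b : Module.Basis κ ℝ E}
  {c : ι → E → ℂ} {F : E → E} {x : E}

/-- The matrix of partial derivatives, in the directions of the basis `b`, of a family `c` of
complex-valued functions on a real vector space. -/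
def complexJacobian (b : Module.Basis κ ℝ E) (c : ι → E → ℂ) (x : E) : Matrix ι κ ℂ :=
  of fun i a => fderiv ℝ (c i) x (b a)

theorem complexJacobian_comp [Fintype κ] [DecidableEq κ]
    (hc : ∀ i, DifferentiableAt ℝ (c i) (F x)) (hF : DifferentiableAt ℝ F x) :
    complexJacobian b (fun i => c i ∘ F) x = complexJacobian b c (F x) *
      (LinearMap.toMatrix b b (fderiv ℝ F x : E →ₗ[ℝ] E)).map Complex.ofReal := by
  ext i a
  have h_expand := congrArg (fderiv ℝ (c i) (F x)) (b.sum_repr (fderiv ℝ F x (b a)))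
  rw [complexJacobian, Matrix.of_apply, fderiv_comp x (hc i) hF, ContinuousLinearMap.comp_apply,
    ← h_expand, map_sum, Matrix.mul_apply]
  refine Finset.sum_congr rfl fun j _ => ?_
  rw [map_smul, Complex.real_smul, mul_comm]
  simp [complexJacobian, LinearMap.toMatrix_apply]

theorem det_complexJacobian_comp [Fintype ι] [DecidableEq ι] {b : Module.Basis ι ℝ E}
    (hc : ∀ i, DifferentiableAt ℝ (c i) (F x)) (hF : DifferentiableAt ℝ F x) :
    (complexJacobian b (fun i => c i ∘ F) x).det =
      (complexJacobian b c (F x)).det * ((fderiv ℝ F x).det : ℂ) := by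
  have h_map := RingHom.map_det Complex.ofRealHom
    (LinearMap.toMatrix b b (fderiv ℝ F x : E →ₗ[ℝ] E))
  rw [LinearMap.det_toMatrix] at h_map
  rw [complexJacobian_comp hc hF, det_mul]
  exact congrArg _ h_map.symm

end ComplexJacobian

section Coordinates

variable {m : ℕ}

/-- Coordinates on `Coord m`: first `θ₁, …, θ_n` (or `u₀, …, u_{n-2}, φ`), then
`μ₁, …, μ_{n-1}` (or `v₀, …, v_{n-2}`). -/
def coordEquiv (m : ℕ) : Coord m ≃ₗ[ℝ] (Fin (m + 1) ⊕ Fin m → ℝ) where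
  toFun x := Sum.elim (theta x) fun k => (x.1 k).2
  invFun f := (fun k => (f (.inl k.castSucc), f (.inr k)), f (.inl (Fin.last m)))
  map_add' x y := by
    ext (j | k)
    · cases j using Fin.lastCases <;> simp [theta]
    · rfl
  map_smul' c x := by
    ext (j | k)
    · cases j using Fin.lastCases <;> simp [theta]
    · rfl
  left_inv x := by simp [theta]
  right_inv f := by
    ext (j | k)
    · cases j using Fin.lastCases <;> simp [theta]
    · rfl

/-- The basis of `Coord m` dual to the coordinates `coordEquiv`. -/
def coordBasis (m : ℕ) : Module.Basis (Fin (m + 1) ⊕ Fin m) ℝ (Coord m) :=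
  Module.Basis.ofEquivFun (coordEquiv m)

theorem coordBasis_fst (a : Fin (m + 1) ⊕ Fin m) (k : Fin m) :
    (coordBasis m a).1 k = ((Pi.single a 1 : _ → ℝ) (.inl k.castSucc),
      (Pi.single a 1 : _ → ℝ) (.inr k)) := by
  rw [coordBasis, Module.Basis.coe_ofEquivFun]
  rfl

theorem coordBasis_snd (a : Fin (m + 1) ⊕ Fin m) :
    (coordBasis m a).2 = (Pi.single a 1 : _ → ℝ) (.inl (Fin.last m)) := by
  rw [coordBasis, Module.Basis.coe_ofEquivFun]
  rfl

theorem theta_add_smul_coordBasis (x : Coord m) (s : ℝ) (a : Fin (m + 1) ⊕ Fin m)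
    (j : Fin (m + 1)) :
    theta (x + s • coordBasis m a) j = theta x j + s * (Pi.single a 1 : _ → ℝ) (.inl j) := by
  cases j using Fin.lastCases <;> simp [theta, coordBasis_fst, coordBasis_snd]

theorem mass_add_smul_coordBasis_inl (x : Coord m) (s : ℝ) (i j : Fin (m + 1)) :
    mass (x + s • coordBasis m (.inl i)) j = mass x j := by
  cases j using Fin.lastCases <;> simp [mass, coordBasis_fst]

theorem mass_add_smul_coordBasis_inr (x : Coord m) (s : ℝ) (l : Fin m) (j : Fin (m + 1)) :
    mass (x + s • coordBasis m (.inr l)) j = mass x j + s *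
      ((Pi.single l.castSucc 1 : _ → ℝ) j - (Pi.single (Fin.last m) 1 : _ → ℝ) j) := by
  cases j using Fin.lastCases with
  | last =>
    simp [mass, coordBasis_fst, Finset.sum_add_distrib, Pi.single_apply]
    ring
  | cast k => simp [mass, coordBasis_fst, Pi.single_apply]

theorem differentiable_theta (j : Fin (m + 1)) : Differentiable ℝ fun x : Coord m => theta x j := by
  cases j using Fin.lastCases <;> simp only [theta, Fin.snoc_last, Fin.snoc_castSucc] <;> fun_prop

theorem differentiable_mass (j : Fin (m + 1)) : Differentiable ℝ fun x : Coord m => mass x j := by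
  cases j using Fin.lastCases <;> simp only [mass, Fin.snoc_last, Fin.snoc_castSucc] <;> fun_prop

theorem sum_mass (x : Coord m) : ∑ j, mass x j = 1 := by
  simp [Fin.sum_univ_castSucc, mass]

theorem verblunsky_castSucc (y : Coord m) (k : Fin m) :
    verblunsky y k.castSucc = (y.1 k).1 + (y.1 k).2 * Complex.I := by
  simp [verblunsky, Complex.mk_eq_add_mul_I]

theorem verblunsky_last (y : Coord m) :
    verblunsky y (Fin.last m) = Complex.exp (y.2 * Complex.I) := by
  simp [verblunsky]

theorem differentiable_verblunsky (j : Fin (m + 1)) :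
    Differentiable ℝ fun y : Coord m => verblunsky y j := by
  have h_ofReal : Differentiable ℝ fun t : ℝ => (t : ℂ) := Complex.ofRealCLM.differentiable
  cases j using Fin.lastCases with
  | last =>
    simp only [verblunsky_last]
    exact ((h_ofReal.comp differentiable_snd).mul_const _).cexp
  | cast k =>
    have h_pair : Differentiable ℝ fun y : Coord m => y.1 k := by fun_prop
    simp only [verblunsky_castSucc]
    exact (h_ofReal.comp h_pair.fst).add ((h_ofReal.comp h_pair.snd).mul_const _)

/-- The index of the Verblunsky coefficient in which a coordinate occurs. -/
def coordIndex : Fin (m + 1) ⊕ Fin m → Fin (m + 1) := Sum.elim id Fin.castSucc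

theorem verblunsky_add_smul_coordBasis_of_ne (y : Coord m) (s : ℝ) {a : Fin (m + 1) ⊕ Fin m}
    {j : Fin (m + 1)} (h : j ≠ coordIndex a) :
    verblunsky (y + s • coordBasis m a) j = verblunsky y j := by
  have h_inl : Sum.inl j ≠ a := by rintro rfl; exact h rfl
  cases j using Fin.lastCases with
  | last => simp [verblunsky_last, coordBasis_snd, h_inl]
  | cast k =>
    have h_inr : Sum.inr k ≠ a := by rintro rfl; exact h rfl
    simp [verblunsky_castSucc, coordBasis_fst, h_inl, h_inr]

theorem hasLineDerivAt_verblunsky_re (y : Coord m) (k : Fin m) :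
    HasLineDerivAt ℝ (verblunsky · k.castSucc) 1 y (coordBasis m (.inl k.castSucc)) := by
  simpa [HasLineDerivAt, verblunsky_castSucc, coordBasis_fst] using
    ((hasDerivAt_id (0 : ℝ)).ofReal_comp.const_add ((y.1 k).1 : ℂ)).add_const
      ((y.1 k).2 * Complex.I)

theorem hasLineDerivAt_verblunsky_im (y : Coord m) (k : Fin m) :
    HasLineDerivAt ℝ (verblunsky · k.castSucc) Complex.I y (coordBasis m (.inr k)) := by
  simpa [HasLineDerivAt, verblunsky_castSucc, coordBasis_fst] using
    (((hasDerivAt_id (0 : ℝ)).ofReal_comp.const_add ((y.1 k).2 : ℂ)).mul_const Complex.I).const_add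
      ((y.1 k).1 : ℂ)

theorem hasLineDerivAt_verblunsky_last (y : Coord m) :
    HasLineDerivAt ℝ (verblunsky · (Fin.last m)) (Complex.I * verblunsky y (Fin.last m)) y
      (coordBasis m (.inl (Fin.last m))) := by
  simpa [HasLineDerivAt, verblunsky_last, coordBasis_snd, mul_comm] using
    (((hasDerivAt_id (0 : ℝ)).ofReal_comp.const_add (y.2 : ℂ)).mul_const Complex.I).cexp

end Coordinates

section VerblunskyJacobian

variable {m : ℕ} {y : Coord m}

theorem det_fromRows_conj {D : Matrix (Fin (m + 1)) (Fin (m + 1) ⊕ Fin m) ℂ}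
    (h_tri : ∀ k a, k < coordIndex a → D k a = 0)
    (h_im : ∀ k : Fin m, D k.castSucc (.inr k) = -Complex.I * D k.castSucc (.inl k.castSucc)) :
    (fromRows D ((D.map star).submatrix Fin.castSucc id)).det =
      (∏ k, D k (.inl k)) * ∏ k : Fin m, 2 * Complex.I * star (D k.castSucc (.inl k.castSucc)) := by
  have h_inl {k j : Fin (m + 1)} (h : k < j) : D k (.inl j) = 0 := h_tri k (.inl j) h
  have h_inr {k : Fin (m + 1)} {j : Fin m} (h : k < j.castSucc) : D k (.inr j) = 0 :=
    h_tri k (.inr j) h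
  have h_order : Function.Injective (Sum.elim (fun k : Fin (m + 1) => 2 * k.val)
      fun k : Fin m => 2 * k.val + 1) := by
    rintro (i | i) (j | j) h <;> grind
  rw [← det_add_mul_inl_col _ Fin.castSucc Complex.I, det_of_lower_triangular_of_injective h_order,
    Fintype.prod_sum_type]
  · congr 1
    refine Finset.prod_congr rfl fun k _ => ?_
    simp [h_im]
    ring
  · rintro (i | i) (j | j) h <;> simp only [Sum.elim_inl, Sum.elim_inr] at h
    · exact h_inl (Fin.lt_def.2 (by omega))
    · change D i (.inr j) + Complex.I * D i (.inl j.castSucc) = 0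
      rcases (Fin.le_def.2 (by simp; omega) : i ≤ j.castSucc).lt_or_eq with hij | rfl
      · simp [h_inl hij, h_inr hij]
      · simp [h_im]
    · simp [h_inl (Fin.lt_def.2 (by simp; omega) : i.castSucc < j)]
    · have hij : i.castSucc < j.castSucc := Fin.lt_def.2 (by simp; omega)
      simp [h_inl hij, h_inr hij]

/-- The moments of orders `1, …, n` and `-1, …, -(n - 1)` as functions of the Verblunsky
coordinates. -/
def coordMoment : Fin (m + 1) ⊕ Fin m → Coord m → ℂ :=
  Sum.elim (fun k y => moment (verblunsky y) (k + 1)) fun k y =>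
    star (moment (verblunsky y) (k.castSucc + 1))

theorem differentiableAt_moment_verblunsky (hy : ∀ k : Fin m, ‖verblunsky y k.castSucc‖ < 1)
    (k : Fin (m + 1)) : DifferentiableAt ℝ (fun y => moment (verblunsky y) (k + 1)) y :=
  differentiableAt_moment (fun l _ => differentiable_verblunsky l y) fun l hl =>
    hy (l.castPred (Fin.ne_last_of_lt hl))

theorem differentiableAt_coordMoment (hy : ∀ k : Fin m, ‖verblunsky y k.castSucc‖ < 1)
    (i : Fin (m + 1) ⊕ Fin m) : DifferentiableAt ℝ (coordMoment i) y := by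
  rcases i with k | k
  · exact differentiableAt_moment_verblunsky hy k
  · exact (differentiableAt_moment_verblunsky hy k.castSucc).star

theorem fderiv_moment_verblunsky (hy : ∀ k : Fin m, ‖verblunsky y k.castSucc‖ < 1)
    {k : Fin (m + 1)} {a : Fin (m + 1) ⊕ Fin m} {d : ℂ} (hk : k ≤ coordIndex a)
    (hd : HasLineDerivAt ℝ (verblunsky · k) d y (coordBasis m a)) :
    fderiv ℝ (fun y => moment (verblunsky y) (k + 1)) y (coordBasis m a) =
      star d * rhoProd (verblunsky y) k ^ 2 := by
  have h_lower (l : Fin (m + 1)) (hl : l < k) (s : ℝ) :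
      verblunsky (y + s • coordBasis m a) l = verblunsky y l :=
    verblunsky_add_smul_coordBasis_of_ne y s (hl.trans_le hk).ne
  have h_line : HasLineDerivAt ℝ (fun y => moment (verblunsky y) (k + 1))
      (star d * rhoProd (verblunsky y) k ^ 2) y (coordBasis m a) := by
    have h := hasDerivAt_moment (fun s l hl => by rw [h_lower l hl, h_lower l hl]) hd
    rwa [zero_smul, add_zero] at h
  rw [← (differentiableAt_moment_verblunsky hy k).lineDeriv_eq_fderiv, h_line.lineDeriv]

theorem fderiv_moment_verblunsky_of_lt (hy : ∀ k : Fin m, ‖verblunsky y k.castSucc‖ < 1)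
    {k : Fin (m + 1)} {a : Fin (m + 1) ⊕ Fin m} (hk : k < coordIndex a) :
    fderiv ℝ (fun y => moment (verblunsky y) (k + 1)) y (coordBasis m a) = 0 := by
  have h_const : HasLineDerivAt ℝ (verblunsky · k) 0 y (coordBasis m a) := by
    simp only [HasLineDerivAt, verblunsky_add_smul_coordBasis_of_ne y _ hk.ne]
    exact hasDerivAt_const _ _
  simp [fderiv_moment_verblunsky hy hk.le h_const]

theorem det_complexJacobian_coordMoment (hy : ∀ k : Fin m, ‖verblunsky y k.castSucc‖ < 1) :
    (complexJacobian (coordBasis m) coordMoment y).det =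
      (∏ k : Fin m, (rhoProd (verblunsky y) k.castSucc : ℂ) ^ 2) ^ 2 * (2 * Complex.I) ^ m *
        (-Complex.I * star (verblunsky y (Fin.last m)) *
          rhoProd (verblunsky y) (Fin.last m) ^ 2) := by
  let D : Matrix (Fin (m + 1)) (Fin (m + 1) ⊕ Fin m) ℂ :=
    complexJacobian (coordBasis m) (fun k y => moment (verblunsky y) (k + 1)) y
  have h_rows : complexJacobian (coordBasis m) coordMoment y =
      fromRows D ((D.map star).submatrix Fin.castSucc id) := by
    ext (k | k) a
    · rfl
    · exact congrArg (· (coordBasis m a))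
        (fderiv_star (𝕜 := ℝ) (f := fun y => moment (verblunsky y) (k.castSucc + 1)))
  have h_tri (k : Fin (m + 1)) (a) (h : k < coordIndex a) : D k a = 0 :=
    fderiv_moment_verblunsky_of_lt hy h
  have h_re (k : Fin m) :
      D k.castSucc (.inl k.castSucc) = (rhoProd (verblunsky y) k.castSucc : ℂ) ^ 2 := by
    have h := fderiv_moment_verblunsky hy (a := .inl k.castSucc) le_rfl
      (hasLineDerivAt_verblunsky_re y k)
    rwa [star_one, one_mul] at h
  have h_im (k : Fin m) :
      D k.castSucc (.inr k) = -Complex.I * D k.castSucc (.inl k.castSucc) := by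
    rw [h_re]
    have h := fderiv_moment_verblunsky hy (a := .inr k) le_rfl (hasLineDerivAt_verblunsky_im y k)
    rwa [Complex.star_def, Complex.conj_I] at h
  have h_last : D (Fin.last m) (.inl (Fin.last m)) = -Complex.I * star (verblunsky y (Fin.last m)) *
      rhoProd (verblunsky y) (Fin.last m) ^ 2 := by
    have h := fderiv_moment_verblunsky hy (a := .inl (Fin.last m)) le_rfl
      (hasLineDerivAt_verblunsky_last y)
    rwa [star_mul', Complex.star_def, Complex.conj_I] at h
  rw [h_rows, det_fromRows_conj h_tri h_im,
    Fin.prod_univ_castSucc, h_last]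
  simp only [h_re, Finset.prod_mul_distrib, Finset.prod_const, Finset.card_fin, star_pow,
    Complex.star_def, Complex.conj_ofReal]
  ring

end VerblunskyJacobian

section SpectralJacobian

variable {m : ℕ}

/-- The point `e^{iθ_j}`. -/
def point (x : Coord m) (j : Fin (m + 1)) : ℂ := Complex.exp (theta x j * Complex.I)

theorem norm_point (x : Coord m) (j : Fin (m + 1)) : ‖point x j‖ = 1 :=
  Complex.norm_exp_ofReal_mul_I _

theorem differentiable_point (j : Fin (m + 1)) : Differentiable ℝ fun x : Coord m => point x j :=
  ((Complex.ofRealCLM.differentiable.comp (differentiable_theta j)).mul_const _).cexp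

theorem point_zpow (x : Coord m) (j : Fin (m + 1)) (k : ℤ) :
    point x j ^ k = Complex.exp (theta x j * (k * Complex.I)) := by
  rw [point, ← Complex.exp_int_mul]
  ring_nf

/-- The moment `∑ μ_j e^{ikθ_j}` of the measure with parameters `x`. -/
def specMoment (k : ℤ) (x : Coord m) : ℂ := ∑ j, (mass x j : ℂ) * point x j ^ k

theorem specMoment_neg (k : ℤ) (x : Coord m) : specMoment (-k) x = star (specMoment k x) := by
  rw [specMoment, specMoment, star_sum]
  refine Finset.sum_congr rfl fun j _ => ?_
  rw [star_mul', Complex.star_def, Complex.conj_ofReal, map_zpow₀,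
    ← Complex.inv_eq_conj (norm_point x j), _root_.inv_zpow, _root_.zpow_neg]

theorem differentiable_specMoment (k : ℤ) : Differentiable ℝ (specMoment (m := m) k) := by
  have h_ofReal : Differentiable ℝ fun t : ℝ => (t : ℂ) := Complex.ofRealCLM.differentiable
  have h_exp : specMoment k = fun x : Coord m =>
      ∑ j, (mass x j : ℂ) * Complex.exp (theta x j * (k * Complex.I)) := by
    ext x
    simp only [specMoment, point_zpow]
  rw [h_exp]
  exact Differentiable.fun_sum fun j _ => (h_ofReal.comp (differentiable_mass j)).mul
    ((h_ofReal.comp (differentiable_theta j)).mul_const _).cexp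

theorem fderiv_specMoment_inl (k : ℤ) (x : Coord m) (i : Fin (m + 1)) :
    fderiv ℝ (specMoment k) x (coordBasis m (.inl i)) =
      Complex.I * mass x i * (k * point x i ^ k) := by
  have h_term (j : Fin (m + 1)) : HasDerivAt
      (fun s : ℝ => (mass x j : ℂ) * point (x + s • coordBasis m (.inl i)) j ^ k)
      (if i = j then Complex.I * mass x j * (k * point x j ^ k) else 0) 0 := by
    simp only [point_zpow, theta_add_smul_coordBasis]
    split_ifs with hij
    · subst hij
      simpa [mul_comm, mul_assoc, mul_left_comm] using
        (((((hasDerivAt_id (0 : ℝ)).ofReal_comp.const_add (theta x i : ℂ)).mul_const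
          (k * Complex.I)).cexp).const_mul (mass x i : ℂ))
    · simpa [hij, Pi.single_apply, Ne.symm hij] using hasDerivAt_const _ _
  have h_line : HasLineDerivAt ℝ (specMoment k) (Complex.I * mass x i * (k * point x i ^ k)) x
      (coordBasis m (.inl i)) := by
    simpa [HasLineDerivAt, specMoment, mass_add_smul_coordBasis_inl] using
      HasDerivAt.fun_sum fun j (_ : j ∈ Finset.univ) => h_term j
  rw [← (differentiable_specMoment k x).lineDeriv_eq_fderiv, h_line.lineDeriv]

theorem fderiv_specMoment_inr (k : ℤ) (x : Coord m) (l : Fin m) :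
    fderiv ℝ (specMoment k) x (coordBasis m (.inr l)) =
      point x l.castSucc ^ k - point x (Fin.last m) ^ k := by
  have h_affine (s : ℝ) : specMoment k (x + s • coordBasis m (.inr l)) =
      specMoment k x + s * (point x l.castSucc ^ k - point x (Fin.last m) ^ k) := by
    simp [specMoment, point, theta_add_smul_coordBasis, mass_add_smul_coordBasis_inr, add_mul,
      mul_assoc, sub_mul, Finset.sum_add_distrib, ← Finset.mul_sum, Pi.single_apply,
      apply_ite Complex.ofReal]
  have h_line : HasLineDerivAt ℝ (specMoment k)
      (point x l.castSucc ^ k - point x (Fin.last m) ^ k) x (coordBasis m (.inr l)) := by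
    simpa [HasLineDerivAt, h_affine] using
      ((hasDerivAt_id (0 : ℝ)).ofReal_comp.mul_const _).const_add (specMoment k x)
  rw [← (differentiable_specMoment k x).lineDeriv_eq_fderiv, h_line.lineDeriv]

/-- The exponents `1, …, n` followed by `-1, …, -(n - 1)`. -/
def momentExponent : Fin (m + 1) ⊕ Fin m → ℤ :=
  Sum.elim (fun k => (k + 1 : ℕ)) fun k => -(k + 1 : ℕ)

/-- Splits off the last index, which carries the exponent `0` of `laurentExponent` and the
mass `μ_n`. -/
def splitLast (m : ℕ) : (Fin (m + 1) ⊕ Fin m) ⊕ Fin 1 ≃ Fin (m + 1) ⊕ Fin (m + 1) :=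
  (Equiv.sumAssoc _ _ _).trans ((Equiv.refl _).sumCongr finSumFinEquiv)

theorem laurentExponent_splitLast_inl (i : Fin (m + 1) ⊕ Fin m) :
    laurentExponent m (splitLast m (.inl i)) = momentExponent i := by
  rcases i with k | k
  · simp [laurentExponent, splitLast, momentExponent]
  · change -(finRotate (m + 1) k.castSucc : ℤ) = -(k + 1 : ℕ)
    rw [coe_finRotate_of_ne_last k.castSucc_lt_last.ne, Fin.val_castSucc]

theorem laurentExponent_splitLast_inr (i : Fin 1) :
    laurentExponent m (splitLast m (.inr i)) = 0 := by
  obtain rfl : i = 0 := Subsingleton.elim _ _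
  change -(finRotate (m + 1) (Fin.last m) : ℤ) = 0
  simp

/-- The relation `∑ μ_j = 1` is accounted for by bordering the Jacobian with the derivatives of the
moment of order `0` with respect to all of `θ₁, …, θ_n, μ₁, …, μ_n`. -/
theorem det_complexJacobian_specMoment (x : Coord m) :
    (complexJacobian (coordBasis m) (fun i => specMoment (momentExponent i)) x).det =
      Complex.I ^ (m + 1) * (∏ j, (mass x j : ℂ)) *
        ((-1) ^ m * ((‖(vandermonde (point x)).det‖ : ℂ) ^ 4 * ∏ j, point x j)) := by
  let scale : Fin (m + 1) ⊕ Fin (m + 1) → ℂ := Sum.elim (fun j => Complex.I * mass x j) fun _ => 1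
  let K := of fun i a => scale a * confluent (laurentExponent m) (point x) i a
  let row (k : ℤ) : (Fin (m + 1) ⊕ Fin m) ⊕ Fin 1 → ℂ :=
    Sum.elim (Sum.elim (fun j => Complex.I * mass x j * (k * point x j ^ k))
      fun l => point x l.castSucc ^ k) fun _ => point x (Fin.last m) ^ k
  have h_det : K.det = Complex.I ^ (m + 1) * (∏ j, (mass x j : ℂ)) *
      (confluent (laurentExponent m) (point x)).det := by
    rw [det_mul_row, Fintype.prod_sum_type]
    simp [scale, Finset.prod_mul_distrib]
  have h_row (p) : K.submatrix (splitLast m) (splitLast m) p =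
      row (laurentExponent m (splitLast m p)) := by
    ext ((j | l) | i)
    · rfl
    · exact one_mul _
    · obtain rfl : i = 0 := Subsingleton.elim _ _
      exact one_mul _
  have h_corner : (K.submatrix (splitLast m) (splitLast m)).toBlocks₂₂ = 1 := by
    ext i a
    obtain rfl : i = a := Subsingleton.elim _ _
    simp [toBlocks₂₂, -submatrix_apply, h_row, row, laurentExponent_splitLast_inr]
  rw [← det_confluent_laurentExponent (norm_point x), ← h_det,
    ← det_submatrix_equiv_self (splitLast m) K, ← fromBlocks_toBlocks (K.submatrix _ _), h_corner,
    det_fromBlocks_one₂₂]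
  congr 1
  ext i (j | l) <;>
    simp [complexJacobian, fderiv_specMoment_inl, fderiv_specMoment_inr, toBlocks₁₁, toBlocks₁₂,
      toBlocks₂₁, Matrix.mul_apply, -submatrix_apply, h_row, row, laurentExponent_splitLast_inl,
      laurentExponent_splitLast_inr]

end SpectralJacobian

section ChangeOfVariables

variable {m : ℕ} {x y : Coord m} {F : Coord m → Coord m}

theorem Corresponds.moment_eq (h : Corresponds x y) (r : ℕ) :
    moment (verblunsky y) r = specMoment r x := by
  rw [moment_of_hasSpectralData h.2]
  simp only [specMoment, point, zpow_natCast]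

theorem Corresponds.coordMoment_eq (h : Corresponds x y) (i : Fin (m + 1) ⊕ Fin m) :
    coordMoment i y = specMoment (momentExponent i) x := by
  rcases i with k | k
  · exact h.moment_eq (k + 1)
  · exact (congrArg star (h.moment_eq (k.castSucc + 1))).trans (specMoment_neg _ x).symm

theorem Corresponds.prod_point (h : Corresponds x y) :
    ∏ j, point x j = (-1) ^ m * star (verblunsky y (Fin.last m)) :=
  (det_of_hasSpectralData h.2).symm.trans (det_cmv fun k => (h.1 k).le)

theorem rhoProd_last_sq (α : Fin (m + 1) → ℂ) :
    rhoProd α (Fin.last m) ^ 2 = ∏ k : Fin m, rho (α k.castSucc) ^ 2 := by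
  rw [rhoProd, Fin.Iio_last_eq_map, Finset.prod_map, Finset.prod_pow]
  rfl

theorem Corresponds.rhoProd_pos (h : Corresponds x y) (i : Fin (m + 1)) :
    0 < rhoProd (verblunsky y) i :=
  CMV.rhoProd_pos fun l hl => h.1 (l.castPred (Fin.ne_last_of_lt hl))

theorem Corresponds.prod_mass_ne_zero (h : Corresponds x y) : ∏ j, mass x j ≠ 0 := by
  have h_prod := prod_rhoProd_sq h.2
  intro h_zero
  rw [h_zero, zero_mul, Finset.prod_eq_zero_iff] at h_prod
  obtain ⟨i, -, hi⟩ := h_prod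
  exact (pow_pos (h.rhoProd_pos i) 2).ne' hi

theorem differentiableAt_verblunsky_of_corresponds (hF : ∀ᶠ y in nhds x, Corresponds y (F y))
    (k : Fin (m + 1)) : DifferentiableAt ℝ (fun y => verblunsky (F y) k) x := by
  refine differentiableAt_of_differentiableAt_moment (γ := fun y => verblunsky (F y))
    (fun k => ?_) ?_ k
  · refine (differentiable_specMoment (k + 1 : ℕ) x).congr_of_eventuallyEq ?_
    filter_upwards [hF] with y hy using hy.moment_eq _
  · filter_upwards [hF] with y hy k hk using hy.1 ⟨k, by omega⟩

theorem differentiableAt_fst_of_corresponds (hF : ∀ᶠ y in nhds x, Corresponds y (F y)) :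
    DifferentiableAt ℝ (fun y => (F y).1) x := by
  refine differentiableAt_pi.2 fun k => ?_
  have h := differentiableAt_verblunsky_of_corresponds hF k.castSucc
  have h_re := Complex.reCLM.differentiableAt.comp x h
  have h_im := Complex.imCLM.differentiableAt.comp x h
  simp only [Function.comp_def, verblunsky, Fin.snoc_castSucc] at h_re h_im
  exact h_re.prodMk h_im

theorem differentiableAt_of_exp_mul_I {E : Type*} [NormedAddCommGroup E] [NormedSpace ℝ E]
    {f : E → ℝ} {x : E} (hc : ContinuousAt f x)
    (hf : DifferentiableAt ℝ (fun y => Complex.exp (f y * Complex.I)) x) :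
    DifferentiableAt ℝ f x := by
  have h_slit : Complex.exp (f x * Complex.I) * Complex.exp (-(f x * Complex.I)) ∈
      Complex.slitPlane := by
    rw [← Complex.exp_add, add_neg_cancel, Complex.exp_zero]
    exact Complex.one_mem_slitPlane
  have h_log : DifferentiableAt ℝ (fun y => f x + (Complex.log
      (Complex.exp (f y * Complex.I) * Complex.exp (-(f x * Complex.I)))).im) x :=
    (Complex.imCLM.differentiableAt.comp x
      (((Complex.differentiableAt_log h_slit).restrictScalars ℝ).comp x
        (hf.mul_const _))).const_add _
  refine h_log.congr_of_eventuallyEq ?_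
  filter_upwards [hc.eventually (Metric.ball_mem_nhds _ Real.pi_pos)] with y hy
  rw [Real.dist_eq, abs_lt] at hy
  have h_im : (f y * Complex.I + -(f x * Complex.I) : ℂ).im = f y - f x := by
    simp [sub_eq_add_neg]
  rw [← Complex.exp_add, Complex.log_exp (by linarith) (by linarith), h_im, add_sub_cancel]

theorem differentiableAt_of_corresponds (hc : ContinuousAt F x)
    (hF : ∀ᶠ y in nhds x, Corresponds y (F y)) : DifferentiableAt ℝ F x := by
  have h_last := differentiableAt_verblunsky_of_corresponds hF (Fin.last m)
  simp only [verblunsky_last] at h_last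
  exact (differentiableAt_fst_of_corresponds hF).prodMk
    (differentiableAt_of_exp_mul_I hc.snd h_last)

theorem det_complexJacobian_coordMoment_mul (hF : ∀ᶠ y in nhds x, Corresponds y (F y))
    (hd : DifferentiableAt ℝ F x) :
    (complexJacobian (coordBasis m) coordMoment (F x)).det * ((fderiv ℝ F x).det : ℂ) =
      (complexJacobian (coordBasis m) (fun i => specMoment (momentExponent i)) x).det := by
  rw [← det_complexJacobian_comp (differentiableAt_coordMoment hF.self_of_nhds.1) hd]
  congr 1
  ext i a
  have h_eq : coordMoment i ∘ F =ᶠ[nhds x] specMoment (momentExponent i) := by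
    filter_upwards [hF] with y hy using hy.coordMoment_eq i
  exact congrArg (fun L : Coord m →L[ℝ] ℂ => L (coordBasis m a)) h_eq.fderiv_eq

theorem Corresponds.prod_mass_mul_det_complexJacobian_specMoment (h : Corresponds x y) :
    (∏ j, (mass x j : ℂ)) *
        (complexJacobian (coordBasis m) (fun i => specMoment (momentExponent i)) x).det =
      Complex.I ^ (m + 1) * star (verblunsky y (Fin.last m)) *
        ((∏ k : Fin m, (rhoProd (verblunsky y) k.castSucc : ℂ) ^ 2) *
          rhoProd (verblunsky y) (Fin.last m) ^ 2) ^ 2 := by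
  have h_prod : (∏ k : Fin m, (rhoProd (verblunsky y) k.castSucc : ℂ) ^ 2) *
      rhoProd (verblunsky y) (Fin.last m) ^ 2 =
        (∏ j, (mass x j : ℂ)) * ‖(vandermonde (point x)).det‖ ^ 2 := by
    rw [← Fin.prod_univ_castSucc fun k => (rhoProd (verblunsky y) k : ℂ) ^ 2]
    exact_mod_cast prod_rhoProd_sq h.2
  have h_sign : ((-1 : ℂ) ^ m) * (-1) ^ m = 1 := by rw [← mul_pow]; simp
  rw [det_complexJacobian_specMoment, h.prod_point, h_prod]
  linear_combination (Complex.I ^ (m + 1) * star (verblunsky y (Fin.last m)) *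
    ((∏ j, (mass x j : ℂ)) * ‖(vandermonde (point x)).det‖ ^ 2) ^ 2) * h_sign

theorem det_fderiv_mul_prod_mass (hF : ∀ᶠ y in nhds x, Corresponds y (F y))
    (hd : DifferentiableAt ℝ F x) :
    (fderiv ℝ F x).det * 2 ^ m * ∏ j, mass x j =
      -∏ k : Fin m, rho (verblunsky (F x) k.castSucc) ^ 2 := by
  have hc : Corresponds x (F x) := hF.self_of_nhds
  have h_det := hc.prod_mass_mul_det_complexJacobian_specMoment
  rw [← det_complexJacobian_coordMoment_mul hF hd, det_complexJacobian_coordMoment hc.1] at h_det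
  have h_lower : ∏ k : Fin m, (rhoProd (verblunsky (F x)) k.castSucc : ℂ) ^ 2 ≠ 0 :=
    Finset.prod_ne_zero_iff.2 fun k _ =>
      pow_ne_zero 2 (Complex.ofReal_ne_zero.2 (hc.rhoProd_pos k.castSucc).ne')
  have h_last : (rhoProd (verblunsky (F x)) (Fin.last m) : ℂ) ^ 2 ≠ 0 :=
    pow_ne_zero 2 (Complex.ofReal_ne_zero.2 (hc.rhoProd_pos (Fin.last m)).ne')
  have h_star : star (verblunsky (F x) (Fin.last m)) ≠ 0 := by
    rw [star_ne_zero, verblunsky_last]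
    exact Complex.exp_ne_zero _
  rw [← rhoProd_last_sq]
  apply Complex.ofReal_injective
  push_cast
  refine mul_left_cancel₀ (mul_ne_zero (mul_ne_zero (pow_ne_zero (m + 1) Complex.I_ne_zero) h_star)
    (mul_ne_zero (pow_ne_zero 2 h_lower) h_last)) ?_
  linear_combination -h_det

theorem det_fderiv_of_corresponds (hF : ∀ᶠ y in nhds x, Corresponds y (F y))
    (hd : DifferentiableAt ℝ F x) :
    (fderiv ℝ F x).det = -((2 : ℝ) ^ (1 - ((m + 1 : ℕ) : ℤ)) *
      ((∏ k : Fin m, rho (verblunsky (F x) k.castSucc) ^ 2) / ∏ j : Fin (m + 1), mass x j)) := by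
  have h_exponent : 1 - ((m + 1 : ℕ) : ℤ) = -(m : ℤ) := by push_cast; ring
  have h_mass : ∏ j, mass x j ≠ 0 := hF.self_of_nhds.prod_mass_ne_zero
  rw [h_exponent, _root_.zpow_neg, zpow_natCast]
  field_simp
  linear_combination det_fderiv_mul_prod_mass hF hd

end ChangeOfVariables

section Existence

variable {m : ℕ}

theorem isOpen_specDomain (m : ℕ) : IsOpen (specDomain m) := by
  have h_eq : specDomain m = (⋂ i, ⋂ j, {x | point x i = point x j → i = j}) ∩
      ⋂ j, {x | 0 < mass x j} := by
    ext x
    simp only [specDomain, Function.Injective, Set.mem_ofPred_eq, Set.mem_inter_iff, Set.mem_iInter]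
    rfl
  rw [h_eq]
  refine (isOpen_iInter_of_finite fun i => isOpen_iInter_of_finite fun j => ?_).inter
    (isOpen_iInter_of_finite fun j => isOpen_lt continuous_const (differentiable_mass j).continuous)
  by_cases hij : i = j
  · simp [hij]
  · simpa [hij] using
      isOpen_ne_fun (differentiable_point (m := m) i).continuous (differentiable_point j).continuous

theorem exp_eq_last_of_hasSpectralData {α : Fin (m + 1) → ℂ} {θ μ : Fin (m + 1) → ℝ}
    (hα : ∀ k : Fin m, ‖α k.castSucc‖ ≤ 1) (h_last : ‖α (Fin.last m)‖ = 1)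
    (h : HasSpectralData (cmv α) θ μ) :
    Complex.exp ((m * Real.pi - ∑ j, θ j : ℝ) * Complex.I) = α (Fin.last m) := by
  have h_pi : Complex.exp (m * Real.pi * Complex.I) = (-1) ^ m := by
    rw [mul_assoc, Complex.exp_nat_mul, Complex.exp_pi_mul_I]
  calc Complex.exp ((m * Real.pi - ∑ j, θ j : ℝ) * Complex.I)
      = (-1) ^ m / ∏ j, Complex.exp (θ j * Complex.I) := by
        push_cast
        rw [sub_mul, Complex.exp_sub, h_pi, Finset.sum_mul, Complex.exp_sum]
    _ = (-1) ^ m / ((-1) ^ m * star (α (Fin.last m))) := by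
        rw [← det_of_hasSpectralData h, det_cmv hα]
    _ = (star (α (Fin.last m)))⁻¹ := by
        rw [← div_div, div_self (pow_ne_zero m (by norm_num)), one_div]
    _ = α (Fin.last m) := by
        rw [Complex.star_def, ← Complex.inv_eq_conj h_last, inv_inv]

/-- The determinant of `C` determines the last Verblunsky coefficient, so that its angle can be
chosen to depend continuously on `x`. -/
theorem exists_corresponds {x : Coord m} (hx : x ∈ specDomain m) :
    ∃ y : Coord m, Corresponds x y ∧ y.2 = m * Real.pi - ∑ j, theta x j := by
  obtain ⟨α, hα, h_last, h⟩ := exists_hasSpectralData hx.1 hx.2 (sum_mass x)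
  let y : Coord m :=
    (fun k => ((α k.castSucc).re, (α k.castSucc).im), m * Real.pi - ∑ j, theta x j)
  have hy : verblunsky y = α := by
    ext k
    cases k using Fin.lastCases with
    | last => rw [verblunsky_last, exp_eq_last_of_hasSpectralData (fun k => (hα k).le) h_last h]
    | cast k => rw [verblunsky_castSucc, Complex.re_add_im]
  exact ⟨y, ⟨hy ▸ hα, hy ▸ h⟩, rfl⟩

theorem exists_isChangeOfVariables (m : ℕ) :
    ∃ F : Coord m → Coord m, IsChangeOfVariables (specDomain m) F := by
  choose! F hF h_angle using fun x : Coord m => exists_corresponds (x := x)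
  refine ⟨F, fun x hx => ContinuousAt.continuousWithinAt ?_, hF⟩
  have h_nhds : ∀ᶠ y in nhds x, y ∈ specDomain m := (isOpen_specDomain m).mem_nhds hx
  have h_fst : ContinuousAt (fun y => (F y).1) x :=
    (differentiableAt_fst_of_corresponds (h_nhds.mono hF)).continuousAt
  have h_snd : ContinuousAt (fun y => (F y).2) x :=
    (continuous_const.sub (continuous_finsetSum _ fun j _ =>
      (differentiable_theta j).continuous)).continuousAt.congr
        (h_nhds.mono fun y hy => (h_angle y hy).symm)
  exact h_fst.prodMk h_snd

end Existence

end CMV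

end

theorem mainTheorem11 (m : ℕ) :
    (∃ F : CMV.Coord m → CMV.Coord m, CMV.IsChangeOfVariables (CMV.specDomain m) F) ∧
    ∀ (U : Set (CMV.Coord m)) (F : CMV.Coord m → CMV.Coord m),
      IsOpen U → U ⊆ CMV.specDomain m → CMV.IsChangeOfVariables U F →
      ∀ x ∈ U, DifferentiableAt ℝ F x ∧
        (fderiv ℝ F x).det =
          -((2 : ℝ) ^ (1 - ((m + 1 : ℕ) : ℤ)) *
            ((∏ k : Fin m, CMV.rho (CMV.verblunsky (F x) k.castSucc) ^ 2) /
              ∏ j : Fin (m + 1), CMV.mass x j)) := by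
  refine ⟨CMV.exists_isChangeOfVariables m, fun U F hU _ hF x hx => ?_⟩
  have hc : ContinuousAt F x := hF.1.continuousAt (hU.mem_nhds hx)
  have h_corr : ∀ᶠ y in nhds x, CMV.Corresponds y (F y) :=
    Filter.mem_of_superset (hU.mem_nhds hx) hF.2
  have hd : DifferentiableAt ℝ F x := CMV.differentiableAt_of_corresponds hc h_corr
  exact ⟨hd, CMV.det_fderiv_of_corresponds h_corr hd⟩
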